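/- **Conventions.** Let $\mathcal X$ (inputs, controlled by the environment) and $\mathcal Y$ (outputs, controlled by the agent) be disjoint finite sets of propositions. LTL$_f$ formulas $\varphi ::= \mathrm{tt}\mid p\mid\neg\varphi\mid\varphi\wedge\varphi\mid\bigcirc\varphi\mid\varphi\,\mathcal U\,\varphi$ over $\mathcal X\cup\mathcal Y$ are interpreted on finite non-empty traces over $2^{\mathcal X\cup\mathcal Y}$ in the usual way ($\bigcirc$ is the strong next). A strategy $g:(2^{\mathcal X})^*\to 2^{\mathcal Y}$ is *winning* for $\varphi$ if for every $X_0X_1\cdots\in(2^{\mathcal X})^\omega$ there is $k\ge 0$ such that $(X_0\cup g(\epsilon))(X_1\cup g(X_0))\cdots(X_k\cup g(X_0\cdots X_{k-1}))\models\varphi$; the specification $(\varphi,\mathcal X,\mathcal Y)$ is *realizable* if a winning strategy exists. For a formula $\psi$, $\mathcal G_\psi$ is the finite DFA obtained on the fly by formula progression up to propositional equivalence. It accepts exactly the non-empty traces that satisfy $\psi$, and its initial state is not accepting. In a DFA game the agent chooses $Y\subseteq\mathcal Y$, then the environment chooses $X\subseteq\mathcal X$, and the state moves along the letter $X\cup Y$;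 the agent wins when an accepting state is reached. The agent-winning region $\mathrm{awr}(\mathcal G)$ of a game $\mathcal G$ is the DFA whose states are agent-winning states of $\mathcal G$ and an extra non-accepting sink $ew$; the transition from $s\neq ew$ under $X\cup Y$ is that of $\mathcal G$ if for every $X'\subseteq\mathcal X$ the $\mathcal G$-successor of $s$ under $X'\cup Y$ is agent-winning, and leads to $ew$ otherwise. **Algorithm** (input $\varphi_1,\dots,\varphi_n$). 1. For $i=1,\dots,n$: solve $\mathcal G_{\varphi_i}$ by depth-first on-the-fly search; if its initial state is not agent-winning, return $\emptyset$. 2. Put $R:=\mathcal G_{\mathrm{tt}}$. For $i=1,\dots,n$: put $R:=\mathrm{Compose}(R,\varphi_i)$; if $R=\mathrm{Null}$, return $\emptyset$. 3. Return the agent strategy built from $R$ by decreasing, in each round, the distance to the accepting states. $\mathrm{Compose}(R,\psi)$ is one of the following. * *Individual composition:* compute $\mathrm{awr}(\mathcal G_\psi)$ by depth-first on-the-fly search and minimize it, form the product $R\times\mathrm{awr}(\mathcal G_\psi)$ and solve this game by backward iteration; return its minimized agent-winning region if its initial state is agent-winning, and Null otherwise. * *Incremental composition:* solve $R\times\mathcal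 G_\psi$ by depth-first on-the-fly search, in which at a state $(s_1,s_2)$ the agent choices $Y$ are skipped that allow a transition of $R$ from $s_1$ to $ew$; return the minimized agent-winning region built from the agent-winning states found if the initial state is among them, and Null otherwise. The depth-first search keeps sets of agent-winning, environment-winning and undetermined states, explores the successors of a state under all agent choices that are not skipped, breaking off a choice as soon as it has an environment-winning successor, and, each time that a strongly connected component is completed, determines the remaining states of that component by backward propagation of the agent-winning states. **Theorem.** For every finite list $\varphi_1,\dots,\varphi_n$ of LTL$_f$ formulas over $\mathcal X\cup\mathcal Y$, for each of the two composition variants, and for all orders in which the loops run through $2^{\mathcal X}$ and $2^{\mathcal Y}$, the algorithm terminates with a unique answer. The specification $(\varphi_1\wedge\cdots\wedge\varphi_n,\mathcal X,\mathcal Y)$ is realizable if and only if this answer is a strategy (that is, not $\emptyset$), and a strategy that is returned is winning for $\varphi_1\wedge\cdots\wedge\varphi_n$. -/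

import Mathlib

open Classical

noncomputable section

namespace CompSynth

/-! ## Linear temporal logic over finite traces -/

/-- Formulas over the atomic propositions `P`. -/
inductive LTLf (P : Type) : Type
  | tt : LTLf P
  | atom (p : P) : LTLf P
  | neg (φ : LTLf P) : LTLf P
  | conj (φ ψ : LTLf P) : LTLf P
  | next (φ : LTLf P) : LTLf P
  | untl (φ ψ : LTLf P) : LTLf P

namespace LTLf

variable {P : Type}

/-- `Sat φ ρ`: the trace `ρ` satisfies `φ`.  Traces are the non-empty lists; on the empty list
(which is never a trace) the same clauses are used as the usual convention for the empty suffix: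
atoms, strong next and until fail there. -/
def Sat : LTLf P → List (Set P) → Prop
  | tt, _ => True
  | atom p, ρ => ∃ a ∈ ρ.head?, p ∈ a
  | neg φ, ρ => ¬ Sat φ ρ
  | conj φ ψ, ρ => Sat φ ρ ∧ Sat ψ ρ
  | next φ, ρ => 1 < ρ.length ∧ Sat φ (ρ.drop 1)
  | untl φ ψ, ρ => ∃ i, i < ρ.length ∧ Sat ψ (ρ.drop i) ∧ ∀ j, j < i → Sat φ (ρ.drop j)

/-- Disjunction, the dual of conjunction. -/
def disj (φ ψ : LTLf P) : LTLf P := neg (conj (neg φ) (neg ψ))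

/-- `φ₁ ∧ ⋯ ∧ φₙ` (the true formula for the empty list). -/
def bigConj : List (LTLf P) → LTLf P
  | [] => tt
  | [φ] => φ
  | φ :: ψ :: φs => conj φ (bigConj (ψ :: φs))

/-- `F tt`: at least one more letter is to come. -/
def nonempty : LTLf P := untl tt tt

/-- Formula progression: the obligation that is left for the rest of the trace after the
letter `σ` has been read while the obligation was the given formula. -/
def progress (σ : Set P) : LTLf P → LTLf P
  | tt => tt
  | atom p => if p ∈ σ then tt else neg tt
  | neg φ => neg (progress σ φ)
  | conj φ ψ => conj (progress σ φ) (progress σ ψ)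
  | next φ => conj φ nonempty
  | untl φ ψ => disj (progress σ ψ) (conj (progress σ φ) (untl φ ψ))

/-- Truth of a formula as a propositional formula, when its atoms, next-subformulas and
until-subformulas are regarded as propositional variables with valuation `v`. -/
def evalProp (v : LTLf P → Prop) : LTLf P → Prop
  | tt => True
  | atom p => v (atom p)
  | neg φ => ¬ evalProp v φ
  | conj φ ψ => evalProp v φ ∧ evalProp v ψ
  | next φ => v (next φ)
  | untl φ ψ => v (untl φ ψ)

/-- Propositional equivalence of formulas. -/
def propSetoid (P : Type) : Setoid (LTLf P) where
  r φ ψ := ∀ v, evalProp v φ ↔ evalProp v ψ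
  iseqv := ⟨fun _ _ => Iff.rfl, fun h v => (h v).symm, fun h k v => (h v).trans (k v)⟩

/-- Formulas up to propositional equivalence. -/
def PropClass (P : Type) : Type := Quotient (propSetoid P)

theorem evalProp_progress (v : LTLf P → Prop) (σ : Set P) (φ : LTLf P) :
    evalProp v (progress σ φ) ↔ evalProp (fun θ => evalProp v (progress σ θ)) φ := by
  induction φ with
  | tt => simp [progress, evalProp]
  | atom p => simp [evalProp]
  | neg φ ih => simp [progress, evalProp, ih]
  | conj φ ψ ih1 ih2 => simp [progress, evalProp, ih1, ih2]
  | next φ => simp [evalProp]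
  | untl φ ψ => simp [evalProp]

/-- The successor of a state (a formula up to propositional equivalence) under a letter. -/
def getSuccessor (q : PropClass P) (σ : Set P) : PropClass P :=
  Quotient.map' (s₁ := propSetoid P) (s₂ := propSetoid P) (progress σ)
    (fun φ ψ h v => by
      rw [evalProp_progress, evalProp_progress]
      exact h _) q

/-- A state is accepting iff its formula holds of the empty rest of the trace, where atoms, next
and until are false. -/
def isAccepting (q : PropClass P) : Prop :=
  Quotient.lift (s := propSetoid P) (evalProp fun _ => False) (fun _ _ h => propext (h _)) q

/-- The initial state for `φ`: the formula `φ` itself, to be satisfied by a non-empty trace. -/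
def initState (φ : LTLf P) : PropClass P := Quotient.mk (propSetoid P) (conj φ nonempty)

/-- The states that are generated from `φ` by successive calls of `getSuccessor`. -/
def states (φ : LTLf P) : Set (PropClass P) :=
  {q | ∃ w : List (Set P), q = w.foldl getSuccessor (initState φ)}

theorem getSuccessor_mem_states {φ : LTLf P} {q : PropClass P} (hq : q ∈ states φ) (σ : Set P) :
    getSuccessor q σ ∈ states φ := by
  obtain ⟨w, rfl⟩ := hq
  exact ⟨w ++ [σ], by simp⟩

/-- The on-the-fly automaton of `φ`. -/
def dfa (φ : LTLf P) : DFA (Set P) (states φ) where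
  step q σ := ⟨getSuccessor q.1 σ, getSuccessor_mem_states q.2 σ⟩
  start := ⟨initState φ, [], rfl⟩
  accept := {q | isAccepting q.1}

/-- The set of subformulas. -/
def subformulas : LTLf P → Set (LTLf P)
  | tt => {tt}
  | atom p => {atom p}
  | neg φ => {neg φ} ∪ subformulas φ
  | conj φ ψ => {conj φ ψ} ∪ (subformulas φ ∪ subformulas ψ)
  | next φ => {next φ} ∪ subformulas φ
  | untl φ ψ => {untl φ ψ} ∪ (subformulas φ ∪ subformulas ψ)

theorem finite_subformulas (φ : LTLf P) : (subformulas φ).Finite := by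
  induction φ with
  | tt => simp [subformulas]
  | atom p => simp [subformulas]
  | neg φ ih => simp [subformulas, ih]
  | conj φ ψ ih1 ih2 => simp [subformulas, ih1, ih2]
  | next φ ih => simp [subformulas, ih]
  | untl φ ψ ih1 ih2 => simp [subformulas, ih1, ih2]

/-- The propositional truth value of `ψ` depends only on the variables in `A`. -/
def SupportedOn (A : Set (LTLf P)) (ψ : LTLf P) : Prop :=
  ∀ v w : LTLf P → Prop, (∀ θ ∈ A, v θ ↔ w θ) → (evalProp v ψ ↔ evalProp w ψ)

theorem supportedOn_of_subformulas {A : Set (LTLf P)} {ψ : LTLf P} (h : subformulas ψ ⊆ A) :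
    SupportedOn A ψ := by
  induction ψ with
  | tt => intro v w _; simp [evalProp]
  | atom p => intro v w hvw; exact hvw _ (h (by simp [subformulas]))
  | neg φ ih =>
    intro v w hvw
    simp only [subformulas, Set.union_subset_iff] at h
    simp [evalProp, ih h.2 v w hvw]
  | conj φ ψ ih1 ih2 =>
    intro v w hvw
    simp only [subformulas, Set.union_subset_iff] at h
    simp [evalProp, ih1 h.2.1 v w hvw, ih2 h.2.2 v w hvw]
  | next φ => intro v w hvw; exact hvw _ (h (by simp [subformulas]))
  | untl φ ψ => intro v w hvw; exact hvw _ (h (by simp [subformulas]))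

theorem supportedOn_progress_sub {A : Set (LTLf P)} (hA : subformulas (nonempty : LTLf P) ⊆ A)
    (σ : Set P) {ψ : LTLf P} (h : subformulas ψ ⊆ A) : SupportedOn A (progress σ ψ) := by
  induction ψ with
  | tt => intro v w _; simp [progress, evalProp]
  | atom p => intro v w _; by_cases hp : p ∈ σ <;> simp [progress, evalProp, hp]
  | neg φ ih =>
    intro v w hvw
    simp only [subformulas, Set.union_subset_iff] at h
    simp [progress, evalProp, ih h.2 v w hvw]
  | conj φ ψ ih1 ih2 =>
    intro v w hvw
    simp only [subformulas, Set.union_subset_iff] at h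
    simp [progress, evalProp, ih1 h.2.1 v w hvw, ih2 h.2.2 v w hvw]
  | next φ =>
    intro v w hvw
    simp only [subformulas, Set.union_subset_iff] at h
    simp only [progress, evalProp, supportedOn_of_subformulas h.2 v w hvw,
      supportedOn_of_subformulas hA v w hvw]
  | untl φ ψ ih1 ih2 =>
    intro v w hvw
    have h0 : v (untl φ ψ) ↔ w (untl φ ψ) := hvw _ (h (by simp [subformulas]))
    simp only [subformulas, Set.union_subset_iff] at h
    simp only [progress, disj, evalProp, ih1 h.2.1 v w hvw, ih2 h.2.2 v w hvw, h0]

theorem supportedOn_progress {A : Set (LTLf P)} (σ : Set P)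
    (hA : ∀ θ ∈ A, SupportedOn A (progress σ θ)) {ψ : LTLf P} (h : SupportedOn A ψ) :
    SupportedOn A (progress σ ψ) := by
  intro v w hvw
  rw [evalProp_progress, evalProp_progress]
  exact h _ _ fun θ hθ => hA θ hθ v w hvw

theorem subformulas_trans {θ ψ : LTLf P} (h : θ ∈ subformulas ψ) :
    subformulas θ ⊆ subformulas ψ := by
  induction ψ with
  | tt => simp only [subformulas, Set.mem_singleton_iff] at h; subst h; rfl
  | atom p => simp only [subformulas, Set.mem_singleton_iff] at h; subst h; rfl
  | neg φ ih =>
    rcases h with h | h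
    · cases h; rfl
    · exact (ih h).trans Set.subset_union_right
  | conj φ ψ ih1 ih2 =>
    rcases h with h | h | h
    · cases h; rfl
    · exact (ih1 h).trans (Set.subset_union_left.trans Set.subset_union_right)
    · exact (ih2 h).trans (Set.subset_union_right.trans Set.subset_union_right)
  | next φ ih =>
    rcases h with h | h
    · cases h; rfl
    · exact (ih h).trans Set.subset_union_right
  | untl φ ψ ih1 ih2 =>
    rcases h with h | h | h
    · cases h; rfl
    · exact (ih1 h).trans (Set.subset_union_left.trans Set.subset_union_right)
    · exact (ih2 h).trans (Set.subset_union_right.trans Set.subset_union_right)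

/-- Only finitely many states are generated from a formula. -/
theorem finite_states (φ : LTLf P) : Finite (states φ) := by
  set A := subformulas (conj φ nonempty) with hAdef
  have hne : subformulas (nonempty : LTLf P) ⊆ A :=
    Set.subset_union_right.trans Set.subset_union_right
  have hA : ∀ σ : Set P, ∀ θ ∈ A, SupportedOn A (progress σ θ) := fun σ θ hθ =>
    supportedOn_progress_sub hne σ (subformulas_trans hθ)
  have hfin : Finite A := (finite_subformulas _).to_subtype
  have key : ∀ q ∈ states φ, ∃ ψ, q = Quotient.mk (propSetoid P) ψ ∧ SupportedOn A ψ := by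
    rintro q ⟨w, rfl⟩
    induction w using List.reverseRecOn with
    | nil => exact ⟨_, rfl, supportedOn_of_subformulas subset_rfl⟩
    | append_singleton w σ ih =>
      obtain ⟨ψ, h1, h2⟩ := ih
      refine ⟨progress σ ψ, ?_, supportedOn_progress σ (hA σ) h2⟩
      rw [List.foldl_append, h1]
      rfl
  have : Nonempty (LTLf P) := ⟨tt⟩
  choose! f hf using key
  refine Finite.of_injective
    (fun q : states φ => {B : Set A | evalProp (fun θ => ∃ h : θ ∈ A, ⟨θ, h⟩ ∈ B) (f q.1)}) ?_
  rintro ⟨q, hq⟩ ⟨r, hr⟩ h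
  apply Subtype.ext
  change q = r
  rw [(hf q hq).1, (hf r hr).1]
  refine Quotient.sound (s := propSetoid P) fun v => ?_
  have e : ∀ θ ∈ A, v θ ↔ ∃ h : θ ∈ A, (⟨θ, h⟩ : A) ∈ {x : A | v x.1} := by
    intro θ hθ
    simp [hθ]
  rw [(hf q hq).2 v _ e, (hf r hr).2 v _ e]
  exact Set.ext_iff.1 h {x : A | v x.1}

theorem sat_iff_evalProp (φ : LTLf P) (ρ : List (Set P)) :
    φ.Sat ρ ↔ evalProp (fun θ => θ.Sat ρ) φ := by
  induction φ with
  | tt => simp [Sat, evalProp]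
  | atom p => simp [evalProp]
  | neg φ ih => simp [Sat, evalProp, ih]
  | conj φ ψ ih1 ih2 => simp [Sat, evalProp, ih1, ih2]
  | next φ => simp [evalProp]
  | untl φ ψ => simp [evalProp]

theorem sat_nonempty (ρ : List (Set P)) : (nonempty : LTLf P).Sat ρ ↔ ρ ≠ [] := by
  constructor
  · rintro ⟨i, hi, -⟩ rfl
    simp at hi
  · intro h
    exact ⟨0, List.length_pos_iff.2 h, trivial, fun j _ => trivial⟩

theorem sat_cons (φ : LTLf P) (σ : Set P) (ρ : List (Set P)) :
    φ.Sat (σ :: ρ) ↔ (progress σ φ).Sat ρ := by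
  induction φ with
  | tt => simp [Sat, progress]
  | atom p => by_cases hp : p ∈ σ <;> simp [Sat, progress, hp]
  | neg φ ih => simp [Sat, progress, ih]
  | conj φ ψ ih1 ih2 => simp [Sat, progress, ih1, ih2]
  | next φ =>
    simp only [progress, Sat, sat_nonempty, List.length_cons, List.drop_succ_cons, List.drop_zero]
    rw [and_comm, ← List.length_pos_iff]
    simp
  | untl φ ψ ih1 ih2 =>
    have h : (progress σ (untl φ ψ)).Sat ρ ↔
        (progress σ ψ).Sat ρ ∨ ((progress σ φ).Sat ρ ∧ (untl φ ψ).Sat ρ) := by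
      simp only [progress, disj, Sat]
      rw [not_and_or, not_not, not_not]
    rw [h, ← ih1, ← ih2]
    constructor
    · rintro ⟨i, hi, h1, h2⟩
      cases i with
      | zero => exact Or.inl h1
      | succ i =>
        refine Or.inr ⟨h2 0 (Nat.succ_pos _), i, by simpa using hi, by simpa using h1, ?_⟩
        intro j hj
        simpa using h2 (j + 1) (by omega)
    · rintro (h1 | ⟨h1, i, hi, h2, h3⟩)
      · exact ⟨0, by simp, by simpa using h1, by simp⟩
      · refine ⟨i + 1, by simpa using hi, by simpa using h2, ?_⟩
        rintro (_ | j) hj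
        · simpa using h1
        · simpa using h3 j (by omega)

/-- The automaton of `φ` recognizes the language of `φ`. -/
theorem mem_accepts_dfa (φ : LTLf P) (ρ : List (Set P)) :
    ρ ∈ φ.dfa.accepts ↔ ρ ≠ [] ∧ φ.Sat ρ := by
  have h1 : ∀ w : List (Set P), ∀ q : states φ,
      (φ.dfa.evalFrom q w).1 = w.foldl getSuccessor q.1 := by
    intro w
    induction w with
    | nil => intro q; rfl
    | cons σ w ih => intro q; exact ih _
  have h2 : ∀ w : List (Set P), ∀ ψ : LTLf P,
      isAccepting (w.foldl getSuccessor (Quotient.mk (propSetoid P) ψ)) ↔ ψ.Sat w := by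
    intro w
    induction w with
    | nil =>
      intro ψ
      rw [sat_iff_evalProp]
      change evalProp (fun _ => False) ψ ↔ _
      induction ψ with
      | tt => simp [evalProp]
      | atom p => simp [evalProp, Sat]
      | neg φ ih => simp [evalProp, ih]
      | conj φ ψ ih1 ih2 => simp [evalProp, ih1, ih2]
      | next φ => simp [evalProp, Sat]
      | untl φ ψ => simp [evalProp, Sat]
    | cons σ w ih =>
      intro ψ
      rw [sat_cons, ← ih]
      rfl
  rw [DFA.mem_accepts]
  change isAccepting (φ.dfa.evalFrom φ.dfa.start ρ).1 ↔ _
  rw [h1]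
  change isAccepting (ρ.foldl getSuccessor (Quotient.mk (propSetoid P) (conj φ nonempty))) ↔ _
  rw [h2, Sat, sat_nonempty, and_comm]

end LTLf

/-! ## Synthesis -/

variable {𝒳 𝒴 : Type}

/-- The letter `X ∪ Y` over the disjoint union of the inputs `𝒳` and the outputs `𝒴`. -/
def letter (X : Set 𝒳) (Y : Set 𝒴) : Set (𝒳 ⊕ 𝒴) := Sum.inl '' X ∪ Sum.inr '' Y

/-- Agent strategies `(2^𝒳)* → 2^𝒴` (the agent moves first in each round). -/
abbrev Strategy (𝒳 𝒴 : Type) : Type := List (Set 𝒳) → Set 𝒴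

/-- The trace `(X₀ ∪ g(ε)) (X₁ ∪ g(X₀)) ⋯ (X_k ∪ g(X₀ ⋯ X_{k-1}))`. -/
def outcome (g : Strategy 𝒳 𝒴) (lam : ℕ → Set 𝒳) (k : ℕ) : List (Set (𝒳 ⊕ 𝒴)) :=
  (List.range (k + 1)).map fun i => letter (lam i) (g ((List.range i).map lam))

/-- `g` is a winning strategy for the specification `(φ, 𝒳, 𝒴)`. -/
def IsWinning (φ : LTLf (𝒳 ⊕ 𝒴)) (g : Strategy 𝒳 𝒴) : Prop :=
  ∀ lam : ℕ → Set 𝒳, ∃ k : ℕ, φ.Sat (outcome g lam k)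

/-- `(φ, 𝒳, 𝒴)` is realizable. -/
def Realizable (φ : LTLf (𝒳 ⊕ 𝒴)) : Prop := ∃ g : Strategy 𝒳 𝒴, IsWinning φ g

/-! ## DFA games and agent-winning regions -/

/-- A DFA game: a deterministic automaton with finitely many states over the alphabet
`2^(𝒳 ∪ 𝒴)`. -/
structure Game (𝒳 𝒴 : Type) where
  State : Type
  finite : Finite State
  dfa : DFA (Set (𝒳 ⊕ 𝒴)) State

namespace Game

/-- The state reached from `s` when the agent plays `Y` and the environment answers `X`. -/
def move (G : Game 𝒳 𝒴) (s : G.State) (X : Set 𝒳) (Y : Set 𝒴) : G.State :=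
  G.dfa.step s (letter X Y)

/-- The game `G_φ`. -/
def ofFormula (φ : LTLf (𝒳 ⊕ 𝒴)) : Game 𝒳 𝒴 := ⟨φ.states, φ.finite_states, φ.dfa⟩

/-- The product game. -/
def prod (G H : Game 𝒳 𝒴) : Game 𝒳 𝒴 where
  State := G.State × H.State
  finite := by
    have := G.finite
    have := H.finite
    infer_instance
  dfa := G.dfa.inter H.dfa

/-- The states from which the agent can enforce an accepting state within `n` rounds. -/
def attractor (G : Game 𝒳 𝒴) : ℕ → Set G.State
  | 0 => G.dfa.accept
  | n + 1 => attractor G n ∪ {s | ∃ Y : Set 𝒴, ∀ X : Set 𝒳, G.move s X Y ∈ attractor G n}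

/-- Solving the game by backward iteration: the resulting set of agent-winning states. -/
def solve (G : Game 𝒳 𝒴) : Set G.State := {s | ∃ n, s ∈ G.attractor n}

end Game

/-- A game in which the states that stand for "the environment wins" (the state `ew` of an
agent-winning region) are marked. -/
structure Region (𝒳 𝒴 : Type) extends Game 𝒳 𝒴 where
  ew : Set State

/-- The agent-winning region of `G` built from a set `W` of agent-winning states: the states are
those of `W` together with `ew`, here `none`; an agent choice `Y` is kept at `s ∈ W` iff all the
environment's answers to it lead into `W`, and everything else leads to `ew`. -/
def buildAwr (G : Game 𝒳 𝒴) (W : Set G.State) (hW : G.dfa.start ∈ W) : Region 𝒳 𝒴 where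
  State := Option W
  finite := by
    have := G.finite
    infer_instance
  dfa :=
    { step := fun o a => match o with
        | none => none
        | some s =>
          if h : ∀ X' : Set 𝒳, G.move s.1 X' (Sum.inr ⁻¹' a) ∈ W then
            some ⟨G.move s.1 (Sum.inl ⁻¹' a) (Sum.inr ⁻¹' a), h _⟩
          else none
      start := some ⟨G.dfa.start, hW⟩
      accept := {o | ∃ s : W, o = some s ∧ s.1 ∈ G.dfa.accept} }
  ew := {none}

namespace Region

/-- Minimization: the minimal automaton of the language of the game, whose states are the left
quotients of that language. The state `ew`, if reachable, stays marked. -/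
def minimize (R : Region 𝒳 𝒴) : Region 𝒳 𝒴 where
  State := Set.range R.dfa.accepts.leftQuotient
  finite := by
    have := R.finite
    have := Fintype.ofFinite R.State
    exact (Language.IsRegular.finite_range_leftQuotient
      (Language.isRegular_iff.2 ⟨R.State, inferInstance, R.dfa, rfl⟩)).to_subtype
  dfa := R.dfa.accepts.toDFA
  ew := {q | ∃ w, R.dfa.eval w ∈ R.ew ∧ q.1 = R.dfa.accepts.leftQuotient w}

/-- The agent choices at `s` that allow the environment to move to `ew`. -/
def ewinAgentChoices (R : Region 𝒳 𝒴) (s : R.State) : Set (Set 𝒴) :=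
  {Y | ∃ X : Set 𝒳, R.move s X Y ∈ R.ew}

/-- The positional strategy that decreases the distance to the accepting states. -/
def position (R : Region 𝒳 𝒴) (s : R.State) : Set 𝒴 :=
  if h : ∃ n, s ∉ R.attractor n ∧ ∃ Y : Set 𝒴, ∀ X : Set 𝒳, R.move s X Y ∈ R.attractor n then
    h.choose_spec.2.choose
  else ∅

/-- The agent strategy that is induced by the positional strategy. -/
def buildStrategy (R : Region 𝒳 𝒴) : Strategy 𝒳 𝒴 := fun history =>
  R.position (history.foldl (fun s X => R.move s X (R.position s)) R.dfa.start)

end Region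

/-! ## Depth-first on-the-fly search -/

/-- The memory of the search: the three sets of states, the edges traversed so far, and the
order in which the states were discovered. -/
structure Search (S : Type) where
  awin : Set S
  ewin : Set S
  undetermined : Set S
  edges : Set (S × S)
  index : S → ℕ
  count : ℕ

namespace Search

variable {S : Type}

/-- The memory at the beginning of the search. -/
def empty : Search S := ⟨∅, ∅, ∅, ∅, fun _ => 0, 0⟩

/-- First visit of `s`. -/
def discover (s : S) (accepting : Prop) (m : Search S) : Search S :=
  { m with
    awin := if accepting then insert s m.awin else m.awin
    undetermined := insert s m.undetermined
    index := Function.update m.index s m.count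
    count := m.count + 1 }

def addEdge (s t : S) (m : Search S) : Search S := { m with edges := insert (s, t) m.edges }

def setAwin (s : S) (m : Search S) : Search S :=
  { m with undetermined := m.undetermined \ {s}, awin := insert s m.awin }

def setEwin (s : S) (m : Search S) : Search S :=
  { m with undetermined := m.undetermined \ {s}, ewin := insert s m.ewin }

/-- `t` can be reached from `s` along the edges traversed so far. -/
def Reaches (m : Search S) (s t : S) : Prop :=
  Relation.ReflTransGen (fun a b => (a, b) ∈ m.edges) s t

/-- The strongly connected component of `s` in the graph traversed so far. -/
def getScc (m : Search S) (s : S) : Set S := {t | m.Reaches s t ∧ m.Reaches t s}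

/-- `s` is the state of its strongly connected component that was discovered first. -/
def IsSccRoot (m : Search S) (s : S) : Prop := ∀ t ∈ m.getScc s, m.index s ≤ m.index t

end Search

section Dfs

variable (G : Game 𝒳 𝒴) (skip : G.State → Set (Set 𝒴))

/-- The states that are found to be agent-winning by propagating the agent-winning states known
so far backwards through the undetermined states of `scc`. -/
inductive BackwardWin (scc : Set G.State) (m : Search G.State) : G.State → Prop
  | known {s : G.State} : s ∈ m.awin → BackwardWin scc m s
  | step {s : G.State} {Y : Set 𝒴} : s ∈ scc → s ∈ m.undetermined → Y ∉ skip s →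
      (∀ X : Set 𝒳, BackwardWin scc m (G.move s X Y)) → BackwardWin scc m s

/-- Backward search in a completed strongly connected component: afterwards each of its states
is determined. -/
def backwardSearch (scc : Set G.State) (m : Search G.State) : Search G.State :=
  { m with
    awin := {s | BackwardWin G skip scc m s}
    ewin := m.ewin ∪ {s | s ∈ scc ∧ s ∈ m.undetermined ∧ ¬ BackwardWin G skip scc m s}
    undetermined := m.undetermined \ scc }

/-- The loop over the environment's choices at `s`, once the agent has chosen `Y`, with `call`
for the recursive calls; the Booleans are `ewin_for_some_X` and `undetermined_for_some_X`. -/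
def loopX (call : G.State → Search G.State → Option (Search G.State)) (s : G.State)
    (Y : Set 𝒴) : List (Set 𝒳) → Bool → Search G.State → Option (Search G.State × Bool × Bool)
  | [], undet, m => some (m, false, undet)
  | X :: Xs, undet, m =>
    (call (G.move s X Y) (m.addEdge s (G.move s X Y))).bind fun m' =>
      if G.move s X Y ∈ m'.ewin then some (m', true, undet)
      else if G.move s X Y ∈ m'.undetermined then loopX call s Y Xs true m'
      else loopX call s Y Xs undet m'

/-- The loop over the agent's choices at `s`; the Boolean is `ewin_for_all_Y`. -/
def loopY (call : G.State → Search G.State → Option (Search G.State)) (Xs : List (Set 𝒳))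
    (s : G.State) : List (Set 𝒴) → Bool → Search G.State → Option (Search G.State × Bool)
  | [], ewinAll, m => some (m, ewinAll)
  | Y :: Ys, ewinAll, m =>
    (loopX G call s Y Xs false m).bind fun r =>
      match r with
      | (m', true, _) => loopY call Xs s Ys ewinAll m'
      | (m', false, true) => loopY call Xs s Ys false m'
      | (m', false, false) => loopY call Xs s Ys false (m'.setAwin s)

/-- The recursive search from a state. The number is a bound on the depth of the recursion;
`none` means that it was too small. `Xs` and `Ys` enumerate `2^𝒳` and `2^𝒴`, and the agent
choices in `skip s` are left out at `s`. -/
def dfSearch (Xs : List (Set 𝒳)) (Ys : List (Set 𝒴)) :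
    ℕ → G.State → Search G.State → Option (Search G.State)
  | 0, _, _ => none
  | depth + 1, s, m =>
    if s ∈ m.awin ∪ m.ewin ∪ m.undetermined then some m
    else
      (loopY G (dfSearch Xs Ys depth) Xs s (Ys.filter fun Y => decide (Y ∉ skip s)) true
        (m.discover s (s ∈ G.dfa.accept))).bind fun r =>
          let m₁ := if r.2 = true ∧ s ∉ r.1.awin then r.1.setEwin s else r.1
          some (if m₁.IsSccRoot s then backwardSearch G skip (m₁.getScc s) m₁ else m₁)

/-- Search from the initial state, then construction and minimization of the agent-winning
region. The outer `none` means that the recursion bound was exceeded, the inner one is the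
answer `Null`. -/
def searchAwr (Xs : List (Set 𝒳)) (Ys : List (Set 𝒴)) (depth : ℕ) :
    Option (Option (Region 𝒳 𝒴)) :=
  (dfSearch G skip Xs Ys depth G.dfa.start Search.empty).bind fun m =>
    some (if h : G.dfa.start ∈ m.awin then some (buildAwr G m.awin h).minimize else none)

end Dfs

/-! ## The compositional synthesis algorithm -/

section Algorithm

variable (Xs : List (Set 𝒳)) (Ys : List (Set 𝒴)) (depth : ℕ)

/-- On-the-fly computation of the agent-winning region of `G_φ`; `Null` if `φ` is found to be
unrealizable. -/
def getAwr (φ : LTLf (𝒳 ⊕ 𝒴)) : Option (Option (Region 𝒳 𝒴)) :=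
  searchAwr (Game.ofFormula φ) (fun _ => ∅) Xs Ys depth

/-- Individual composition. -/
def composeIndividual (R : Region 𝒳 𝒴) (ψ : LTLf (𝒳 ⊕ 𝒴)) : Option (Option (Region 𝒳 𝒴)) :=
  (getAwr Xs Ys depth ψ).bind fun r =>
    match r with
    | none => some none
    | some R₂ =>
      let G := R.toGame.prod R₂.toGame
      some (if h : G.dfa.start ∈ G.solve then some (buildAwr G G.solve h).minimize else none)

/-- Incremental composition. -/
def composeIncremental (R : Region 𝒳 𝒴) (ψ : LTLf (𝒳 ⊕ 𝒴)) : Option (Option (Region 𝒳 𝒴)) :=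
  searchAwr (R.toGame.prod (Game.ofFormula ψ)) (fun s => R.ewinAgentChoices s.1) Xs Ys depth

/-- The two composition variants. -/
inductive Variant
  | individual
  | incremental

def compose (v : Variant) (R : Region 𝒳 𝒴) (ψ : LTLf (𝒳 ⊕ 𝒴)) : Option (Option (Region 𝒳 𝒴)) :=
  match v with
  | .individual => composeIndividual Xs Ys depth R ψ
  | .incremental => composeIncremental Xs Ys depth R ψ

/-- The first loop: is there a conjunct that on-the-fly synthesis finds to be unrealizable? -/
def someUnrealizable : List (LTLf (𝒳 ⊕ 𝒴)) → Option Bool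
  | [] => some false
  | φ :: φs => (getAwr Xs Ys depth φ).bind fun r =>
      match r with
      | none => some true
      | some _ => someUnrealizable φs

/-- The second loop. -/
def composeAll (v : Variant) : List (LTLf (𝒳 ⊕ 𝒴)) → Region 𝒳 𝒴 → Option (Option (Region 𝒳 𝒴))
  | [], R => some (some R)
  | φ :: φs, R => (compose Xs Ys depth v R φ).bind fun r =>
      match r with
      | none => some none
      | some R' => composeAll v φs R'

/-- Compositional synthesis for `φ₁ ∧ ⋯ ∧ φₙ`, with a bound on the depth of the recursion in the
depth-first searches. The outer `none` means that the bound was exceeded; `some none` is the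
answer `∅`, and `some (some g)` means that the strategy `g` is returned. -/
def synthesize (v : Variant) (φs : List (LTLf (𝒳 ⊕ 𝒴))) : Option (Option (Strategy 𝒳 𝒴)) :=
  (someUnrealizable Xs Ys depth φs).bind fun b =>
    match b with
    | true => some none
    | false =>
      (composeAll Xs Ys depth v φs ⟨Game.ofFormula LTLf.tt, ∅⟩).bind fun r =>
        match r with
        | none => some none
        | some R => some (some R.buildStrategy)

end Algorithm

/-- Compositional synthesis, with the composition variant `v` and with loops over `2^𝒳` and `2^𝒴`
in the order of `Xs` and `Ys`, terminates on `φ₁ ∧ ⋯ ∧ φₙ` with the answer `r` (`none` for the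
answer `∅`): it gives this answer without exceeding some recursion depth. -/
def Returns (Xs : List (Set 𝒳)) (Ys : List (Set 𝒴)) (v : Variant) (φs : List (LTLf (𝒳 ⊕ 𝒴)))
    (r : Option (Strategy 𝒳 𝒴)) : Prop :=
  ∃ depth : ℕ, synthesize Xs Ys depth v φs = some r

end CompSynth

end

namespace CompSynth

variable {𝒳 𝒴 : Type}

/-! ## Winning in terms of words -/

/-! Whether the agent wins depends on the language of a game, not on its automaton. `AgentWins L w`
therefore defines winning on histories, and `Game.eval_mem_solve_iff` identifies it with backward
iteration in every automaton for `L`. Product, minimization and restriction to a region then become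
statements about languages.

An agent-winning region for `L` accepts exactly the words of `L` that are `Safe` for `L`
(`mem_accepts_buildAwr`). A winning play for a sublanguage of `L` only uses choices all of whose
answers are winning for `L`, so it stays safe (`AgentWins.inter_safe`). Hence cutting `L` down to
its safe part costs the agent nothing, whatever conjuncts are still to come. `IsComposeAnswer`
records this with an arbitrary further language `N`, and the induction in `composeAll_spec` takes
for `N` the language of the remaining conjuncts.

The depth-first search is correct by a Tarjan-style invariant (`SearchInv`). A completed state that
is still undetermined reaches an open state, so when a component is completed its undetermined
states have successors only among determined states and the component itself. What backward
propagation leaves over is then an environment trap. No state is open at the end, so every visited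
state is classified correctly, which suffices for building the region (`IsWinningCore`).

A recursion bound above the number of states suffices (`dfSearch_spec`), and raising the bound never
changes an answer (`synthesize_mono`). This gives termination with a unique answer. Winning on
histories is linked to strategies by `agentWins_nil_of_strategy` and
`exists_outcome_mem_of_start_mem_solve`. -/

/-- From the history `w`, the agent can enforce that the play gets into the language `L`. -/
inductive AgentWins (L : Language (Set (𝒳 ⊕ 𝒴))) : List (Set (𝒳 ⊕ 𝒴)) → Prop
  | mem {w : List (Set (𝒳 ⊕ 𝒴))} : w ∈ L → AgentWins L w
  | step {w : List (Set (𝒳 ⊕ 𝒴))} (Y : Set 𝒴) :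
      (∀ X : Set 𝒳, AgentWins L (w ++ [letter X Y])) → AgentWins L w

/-- Every agent choice in `w` was such that all answers of the environment to it are
agent-winning for `L`. -/
def Safe (L : Language (Set (𝒳 ⊕ 𝒴))) (w : List (Set (𝒳 ⊕ 𝒴))) : Prop :=
  ∀ u σ, u ++ [σ] <+: w → ∀ X : Set 𝒳, AgentWins L (u ++ [letter X (Sum.inr ⁻¹' σ)])

theorem letter_preimage (σ : Set (𝒳 ⊕ 𝒴)) :
    letter (Sum.inl ⁻¹' σ : Set 𝒳) (Sum.inr ⁻¹' σ : Set 𝒴) = σ := by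
  ext (x | y) <;> simp [letter]

theorem inr_preimage_letter (X : Set 𝒳) (Y : Set 𝒴) : Sum.inr ⁻¹' letter X Y = Y := by
  ext y; simp [letter]

theorem AgentWins.mono {L M : Language (Set (𝒳 ⊕ 𝒴))} (h : ∀ w ∈ L, w ∈ M)
    {w : List (Set (𝒳 ⊕ 𝒴))} (hw : AgentWins L w) : AgentWins M w := by
  induction hw with
  | mem hw => exact .mem (h _ hw)
  | step Y _ ih => exact .step Y ih

theorem safe_nil (L : Language (Set (𝒳 ⊕ 𝒴))) : Safe L [] := by
  intro u σ h
  simp at h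

theorem safe_concat {L : Language (Set (𝒳 ⊕ 𝒴))} {w : List (Set (𝒳 ⊕ 𝒴))} {σ : Set (𝒳 ⊕ 𝒴)} :
    Safe L (w ++ [σ]) ↔
      Safe L w ∧ ∀ X : Set 𝒳, AgentWins L (w ++ [letter X (Sum.inr ⁻¹' σ)]) := by
  constructor
  · intro h
    exact ⟨fun u τ hu => h u τ (hu.trans (List.prefix_append _ _)), h w σ List.prefix_rfl⟩
  · rintro ⟨h1, h2⟩ u τ hu
    rcases List.prefix_concat_iff.1 hu with h | h
    · obtain ⟨h3, h4⟩ := List.append_inj' h rfl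
      rw [h3, List.singleton_inj.1 h4]
      exact h2
    · exact h1 u τ h

/-- A play that is won for a sublanguage of `L` can be kept safe for `L`. -/
theorem AgentWins.inter_safe {L M N : Language (Set (𝒳 ⊕ 𝒴))} (hL : ∀ w ∈ M, w ∈ L)
    (hN : ∀ w ∈ M, Safe L w → w ∈ N) {w : List (Set (𝒳 ⊕ 𝒴))} (hw : AgentWins M w)
    (hs : Safe L w) : AgentWins N w := by
  induction hw with
  | mem hw => exact .mem (hN _ hw hs)
  | @step w Y h ih =>
    -- The derivation puts every answer to `Y` among the winning histories for `M`, hence for `L`,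
    -- so playing `Y` keeps the history safe.
    refine .step Y fun X => ih X (safe_concat.2 ⟨hs, fun X' => ?_⟩)
    rw [inr_preimage_letter]
    exact (h X').mono hL

/-! ## Backward iteration -/

namespace Game

variable (G : Game 𝒳 𝒴)

theorem attractor_mono : Monotone G.attractor :=
  monotone_nat_of_le_succ fun _ => Set.subset_union_left

theorem accept_subset_solve : G.dfa.accept ⊆ G.solve := fun _ h => ⟨0, h⟩

/-- The environment has only finitely many answers, so their ranks have a common bound. -/
theorem exists_attractor_of_forall_mem_solve [Finite 𝒳] {s : G.State} {Y : Set 𝒴}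
    (h : ∀ X : Set 𝒳, G.move s X Y ∈ G.solve) :
    ∃ n, ∀ X : Set 𝒳, G.move s X Y ∈ G.attractor n := by
  choose n hn using h
  obtain ⟨b, hb⟩ := (Set.finite_range n).bddAbove
  exact ⟨b, fun X => G.attractor_mono (hb ⟨X, rfl⟩) (hn X)⟩

theorem mem_solve_of_forall [Finite 𝒳] {s : G.State} (Y : Set 𝒴)
    (h : ∀ X : Set 𝒳, G.move s X Y ∈ G.solve) : s ∈ G.solve := by
  obtain ⟨n, hn⟩ := G.exists_attractor_of_forall_mem_solve h
  exact ⟨n + 1, Or.inr ⟨Y, hn⟩⟩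

/-- Agent-winning states and environment traps are disjoint. -/
theorem notMem_solve_of_trap {T : Set G.State}
    (hT : ∀ s ∈ T, s ∉ G.dfa.accept ∧ ∀ Y : Set 𝒴, ∃ X : Set 𝒳,
      G.move s X Y ∈ T ∨ G.move s X Y ∉ G.solve)
    {s : G.State} (hs : s ∈ T) : s ∉ G.solve := by
  rintro ⟨n, hn⟩
  induction n generalizing s with
  | zero => exact (hT s hs).1 hn
  | succ n ih =>
    rcases hn with hn | ⟨Y, hY⟩
    · exact ih hs hn
    -- Staying in the trap lowers the rank; leaving the winning states is absurd. The second
    -- alternative will serve the agent choices that the search skips.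
    · obtain ⟨X, hX | hX⟩ := (hT s hs).2 Y
      · exact ih hX (hY X)
      · exact hX ⟨n, hY X⟩

/-- One play with the environment always answering `∅` is enough. It is used contrapositively: dead
states are not agent-winning. -/
theorem exists_mem_acceptsFrom {s : G.State} (hs : s ∈ G.solve) :
    ∃ w, w ∈ G.dfa.acceptsFrom s := by
  obtain ⟨n, hn⟩ := hs
  induction n generalizing s with
  | zero => exact ⟨[], hn⟩
  | succ n ih =>
    rcases hn with hn | ⟨Y, hY⟩
    · exact ih hn
    · obtain ⟨w, hw⟩ := ih (hY ∅)
      exact ⟨letter ∅ Y :: w, hw⟩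

theorem eval_append_letter (w : List (Set (𝒳 ⊕ 𝒴))) (X : Set 𝒳) (Y : Set 𝒴) :
    G.dfa.eval (w ++ [letter X Y]) = G.move (G.dfa.eval w) X Y := by
  simp [move]

theorem eval_mem_solve_iff [Finite 𝒳] {w : List (Set (𝒳 ⊕ 𝒴))} :
    G.dfa.eval w ∈ G.solve ↔ AgentWins G.dfa.accepts w := by
  constructor
  · rintro ⟨n, hn⟩
    induction n generalizing w with
    | zero => exact .mem hn
    | succ n ih =>
      rcases hn with hn | ⟨Y, hY⟩
      · exact ih hn
      · exact .step Y fun X => ih (by rw [eval_append_letter]; exact hY X)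
  · intro h
    induction h with
    | mem h => exact G.accept_subset_solve h
    | step Y _ ih =>
      exact G.mem_solve_of_forall Y fun X => by rw [← eval_append_letter]; exact ih X

theorem start_mem_solve_iff [Finite 𝒳] :
    G.dfa.start ∈ G.solve ↔ AgentWins G.dfa.accepts [] := G.eval_mem_solve_iff (w := [])

end Game

theorem mem_accepts_prod {G H : Game 𝒳 𝒴} {w : List (Set (𝒳 ⊕ 𝒴))} :
    w ∈ (G.prod H).dfa.accepts ↔ w ∈ G.dfa.accepts ∧ w ∈ H.dfa.accepts := by
  change w ∈ (G.dfa.inter H.dfa).accepts ↔ _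
  rw [DFA.accepts_inter]
  rfl

/-! ## Agent-winning regions -/

/-- `W` consists of agent-winning states, and contains all successors of its states under those
agent choices that are certain to lead to agent-winning states. -/
structure IsWinningCore (G : Game 𝒳 𝒴) (W : Set G.State) : Prop where
  sound : W ⊆ G.solve
  closed : ∀ s ∈ W, ∀ Y : Set 𝒴, (∀ X : Set 𝒳, G.move s X Y ∈ G.solve) →
    ∀ X : Set 𝒳, G.move s X Y ∈ W

theorem isWinningCore_solve (G : Game 𝒳 𝒴) : IsWinningCore G G.solve :=
  ⟨subset_rfl, fun _ _ _ h => h⟩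

/-- The region follows `G` while the history is safe and falls into the sink at the first unsafe
choice. Any winning core gives the same behaviour on words, so the search need not find all of
`G.solve`. -/
theorem eval_buildAwr [Finite 𝒳] {G : Game 𝒳 𝒴} {W : Set G.State} (hW : IsWinningCore G W)
    (h0 : G.dfa.start ∈ W) (w : List (Set (𝒳 ⊕ 𝒴))) :
    (Safe G.dfa.accepts w ∧ ∃ h : G.dfa.eval w ∈ W,
      (buildAwr G W h0).dfa.eval w = some ⟨G.dfa.eval w, h⟩) ∨
    (¬ Safe G.dfa.accepts w ∧ (buildAwr G W h0).dfa.eval w = none) := by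
  induction w using List.reverseRecOn with
  | nil => exact Or.inl ⟨safe_nil _, h0, rfl⟩
  | append_singleton w σ ih =>
    have hmove : G.move (G.dfa.eval w) (Sum.inl ⁻¹' σ) (Sum.inr ⁻¹' σ) =
        G.dfa.eval (w ++ [σ]) := by
      rw [← G.eval_append_letter, letter_preimage]
    rw [DFA.eval_append_singleton (M := (buildAwr G W h0).dfa)]
    rcases ih with ⟨h1, h2, h3⟩ | ⟨h1, h3⟩
    · rw [h3]
      by_cases h : ∀ X' : Set 𝒳, G.move (G.dfa.eval w) X' (Sum.inr ⁻¹' σ) ∈ W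
      · refine Or.inl ⟨safe_concat.2 ⟨h1, fun X => ?_⟩, ?_⟩
        · rw [← G.eval_mem_solve_iff, G.eval_append_letter]
          exact hW.sound (h X)
        · refine ⟨hmove ▸ h _, ?_⟩
          refine (dif_pos h).trans ?_
          congr 2
      · refine Or.inr ⟨fun hs => h (hW.closed _ h2 _ fun X => ?_), dif_neg h⟩
        rw [← G.eval_append_letter, G.eval_mem_solve_iff]
        exact (safe_concat.1 hs).2 X
    · rw [h3]
      exact Or.inr ⟨fun hs => h1 (safe_concat.1 hs).1, rfl⟩

theorem mem_accepts_buildAwr [Finite 𝒳] {G : Game 𝒳 𝒴} {W : Set G.State}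
    (hW : IsWinningCore G W) (h0 : G.dfa.start ∈ W) {w : List (Set (𝒳 ⊕ 𝒴))} :
    w ∈ (buildAwr G W h0).dfa.accepts ↔ w ∈ G.dfa.accepts ∧ Safe G.dfa.accepts w := by
  have hacc : w ∈ (buildAwr G W h0).dfa.accepts ↔
      ∃ s : W, (buildAwr G W h0).dfa.eval w = some s ∧ s.1 ∈ G.dfa.accept := Iff.rfl
  rw [hacc]
  rcases eval_buildAwr hW h0 w with ⟨h1, h2, h3⟩ | ⟨h1, h3⟩
  · rw [h3]
    constructor
    · rintro ⟨s, h4, h5⟩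
      cases h4
      exact ⟨h5, h1⟩
    · rintro ⟨h4, -⟩
      exact ⟨_, rfl, h4⟩
  · rw [h3]
    constructor
    · rintro ⟨s, h4, -⟩
      cases h4
    · exact fun h => absurd h.2 h1

namespace Region

/-- The states marked as `ew` are dead: no accepting state is reachable from them. -/
def EwDead (R : Region 𝒳 𝒴) : Prop := ∀ s ∈ R.ew, ∀ w, w ∉ R.dfa.acceptsFrom s

theorem accepts_minimize (R : Region 𝒳 𝒴) : R.minimize.dfa.accepts = R.dfa.accepts :=
  Language.accepts_toDFA _

/-- A state of the minimal automaton is the language accepted from it, and the quotient by a word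
that leads to a dead state is empty. -/
theorem EwDead.minimize {R : Region 𝒳 𝒴} (hR : R.EwDead) : R.minimize.EwDead := by
  have key : ∀ (w : List (Set (𝒳 ⊕ 𝒴))) (q : Set.range R.dfa.accepts.leftQuotient),
      w ∈ R.dfa.accepts.toDFA.acceptsFrom q ↔ w ∈ q.1 := by
    intro w
    induction w with
    | nil => exact fun q => Iff.rfl
    | cons σ w ih => exact fun q => ih _
  rintro q ⟨u, hu, hq⟩ w hw
  have hw' : w ∈ q.1 := (key w q).1 hw
  rw [hq, Language.leftQuotient_accepts_apply] at hw'
  exact hR _ hu w hw'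

theorem ewDead_buildAwr (G : Game 𝒳 𝒴) (W : Set G.State) (h0 : G.dfa.start ∈ W) :
    (buildAwr G W h0).EwDead := by
  rintro _ rfl w hw
  induction w with
  | nil =>
    obtain ⟨s, hs, -⟩ := hw
    cases hs
  | cons σ w ih => exact ih hw

/-- This makes skipping harmless: a skipped choice lets the environment reach a state that is dead
in the first component, hence lost in the product. -/
theorem EwDead.exists_notMem_solve_prod {R : Region 𝒳 𝒴} (hR : R.EwDead) (H : Game 𝒳 𝒴)
    {s : (R.toGame.prod H).State} {Y : Set 𝒴} (hY : Y ∈ R.ewinAgentChoices s.1) :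
    ∃ X : Set 𝒳, (R.toGame.prod H).move s X Y ∉ (R.toGame.prod H).solve := by
  obtain ⟨X, hX⟩ := hY
  refine ⟨X, fun h => ?_⟩
  obtain ⟨w, hw⟩ := Game.exists_mem_acceptsFrom _ h
  have hw' : w ∈ (R.dfa.inter H.dfa).acceptsFrom (R.move s.1 X Y, H.move s.2 X Y) := hw
  rw [DFA.acceptsFrom_inter] at hw'
  exact hR _ hX w hw'.1

/-! ## The strategy of a region -/

/-- The rank chosen in `position` is one at which `s` is not yet won, so by monotonicity it is at
most any `n` with `s` in stage `n + 1`. The rank therefore drops for the given `n`, not just for the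
chosen one. -/
theorem exists_position_mem (R : Region 𝒳 𝒴) {n : ℕ} {s : R.State}
    (hs : s ∈ R.attractor (n + 1)) (hn : s ∉ R.attractor 0) :
    ∀ X : Set 𝒳, R.move s X (R.position s) ∈ R.attractor n := by
  have hex : ∃ n, s ∉ R.attractor n ∧ ∃ Y : Set 𝒴, ∀ X : Set 𝒳, R.move s X Y ∈ R.attractor n := by
    induction n with
    | zero => exact ⟨0, hn, hs.resolve_left hn⟩
    | succ n ih =>
      by_cases h : s ∈ R.attractor (n + 1)
      · exact ih h
      · exact ⟨n + 1, h, hs.resolve_left h⟩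
  have h1 : hex.choose ≤ n := by
    by_contra hlt
    exact hex.choose_spec.1 (R.attractor_mono (by omega) hs)
  intro X
  have h2 := hex.choose_spec.2.choose_spec X
  have h3 : R.position s = hex.choose_spec.2.choose := dif_pos hex
  rw [h3]
  exact R.attractor_mono h1 h2

end Region

theorem outcome_eq_append (g : Strategy 𝒳 𝒴) (lam : ℕ → Set 𝒳) (k : ℕ) :
    outcome g lam k = (List.range k).map (fun i => letter (lam i) (g ((List.range i).map lam))) ++
      [letter (lam k) (g ((List.range k).map lam))] := by
  simp [outcome, List.range_succ]

theorem exists_outcome_mem_of_start_mem_solve (R : Region 𝒳 𝒴) (h0 : R.dfa.start ∈ R.solve)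
    (hne : [] ∉ R.dfa.accepts) (lam : ℕ → Set 𝒳) :
    ∃ k, outcome R.buildStrategy lam k ∈ R.dfa.accepts := by
  set pre : ℕ → List (Set (𝒳 ⊕ 𝒴)) := fun k => (List.range k).map
    fun i => letter (lam i) (R.buildStrategy ((List.range i).map lam)) with hpre
  have hpos : ∀ k, R.buildStrategy ((List.range k).map lam) = R.position (R.dfa.eval (pre k)) := by
    intro k
    have : ((List.range k).map lam).foldl (fun s X => R.move s X (R.position s)) R.dfa.start =
        R.dfa.eval (pre k) := by
      induction k with
      | zero => rfl
      | succ k ih =>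
        have h : R.buildStrategy ((List.range k).map lam) =
          R.position (R.dfa.eval (pre k)) := congrArg R.position ih
        rw [List.range_succ, List.map_append, List.foldl_append, ih]
        simp only [hpre, List.range_succ, List.map_append, List.map_cons, List.map_nil,
          R.eval_append_letter, List.foldl_cons, List.foldl_nil]
        rw [h]
    exact congrArg R.position this
  have hsucc : ∀ k, outcome R.buildStrategy lam k = pre (k + 1) := fun k => rfl
  have hmain : ∀ n k, R.dfa.eval (pre k) ∈ R.attractor n → ∃ j, pre j ∈ R.dfa.accepts := by
    intro n
    induction n with
    | zero => exact fun k hk => ⟨k, hk⟩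
    | succ n ih =>
      intro k hk
      by_cases hacc : R.dfa.eval (pre k) ∈ R.attractor 0
      · exact ⟨k, hacc⟩
      · refine ih (k + 1) ?_
        rw [← hsucc, outcome_eq_append, R.eval_append_letter, hpos]
        exact R.exists_position_mem hk hacc _
  obtain ⟨n, hn⟩ := h0
  obtain ⟨j, hj⟩ := hmain n 0 hn
  -- Outcomes have length at least one, so acceptance of the empty history has to be excluded.
  cases j with
  | zero => exact absurd hj hne
  | succ k => exact ⟨k, hj⟩

/-- If some strategy forces the play into `L`, then the agent wins from the empty history. -/
theorem agentWins_nil_of_strategy {L : Language (Set (𝒳 ⊕ 𝒴))} (g : Strategy 𝒳 𝒴)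
    (hg : ∀ lam : ℕ → Set 𝒳, ∃ k, outcome g lam k ∈ L) : AgentWins L [] := by
  by_contra h0
  have hstep : ∀ (w : List (Set (𝒳 ⊕ 𝒴))) (Y : Set 𝒴), ¬ AgentWins L w →
      ∃ X : Set 𝒳, ¬ AgentWins L (w ++ [letter X Y]) := by
    intro w Y hw
    by_contra! h
    exact hw (.step Y h)
  choose! f hf using hstep
  -- If the agent does not win, `f` keeps every losing history losing. The play of `g` against `f`
  -- is built as a pair, since `g` reads the inputs and `f` the whole trace.
  let st : ℕ → List (Set 𝒳) × List (Set (𝒳 ⊕ 𝒴)) := fun k => k.rec ([], []) fun _ p =>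
    (p.1 ++ [f p.2 (g p.1)], p.2 ++ [letter (f p.2 (g p.1)) (g p.1)])
  let lam : ℕ → Set 𝒳 := fun k => f (st k).2 (g (st k).1)
  have h1 : ∀ k, (st k).1 = (List.range k).map lam := by
    intro k
    induction k with
    | zero => rfl
    | succ k ih =>
      rw [List.range_succ, List.map_append, ← ih]
      rfl
  have h2 : ∀ k, (st k).2 =
      (List.range k).map fun i => letter (lam i) (g ((List.range i).map lam)) := by
    intro k
    induction k with
    | zero => rfl
    | succ k ih =>
      rw [List.range_succ, List.map_append, ← ih, List.map_singleton, ← h1]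
  have h3 : ∀ k, ¬ AgentWins L (st k).2 := by
    intro k
    induction k with
    | zero => exact h0
    | succ k ih => exact hf _ _ ih
  obtain ⟨k, hk⟩ := hg lam
  exact h3 (k + 1) (.mem (Eq.mpr (congrArg (· ∈ L) (h2 (k + 1))) hk))

/-! ## Correctness of the depth-first search -/

namespace Search

variable {S : Type}

/-- The states visited so far. -/
def discovered (m : Search S) : Set S := m.awin ∪ m.ewin ∪ m.undetermined

theorem discovered_discover (s : S) (p : Prop) (m : Search S) :
    (m.discover s p).discovered = insert s m.discovered := by
  ext x
  by_cases hp : p <;> simp [discovered, discover, hp]; tauto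

theorem discovered_setAwin {s : S} {m : Search S} (hs : s ∈ m.discovered) :
    (m.setAwin s).discovered = m.discovered := by
  ext x
  by_cases hx : x = s
  · subst hx
    simpa [discovered, setAwin] using hs
  · simp [discovered, setAwin, hx]

theorem discovered_setEwin {s : S} {m : Search S} (hs : s ∈ m.discovered) :
    (m.setEwin s).discovered = m.discovered := by
  ext x
  by_cases hx : x = s
  · subst hx
    simpa [discovered, setEwin] using hs
  · simp [discovered, setEwin, hx]

theorem Reaches.mono {m m' : Search S} (h : m.edges ⊆ m'.edges) {s t : S} (hst : m.Reaches s t) :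
    m'.Reaches s t :=
  Relation.ReflTransGen.mono (fun _ _ hab => h hab) _ _ hst

/-- The knowledge about winning states and edges has grown from `m` to `m'`. -/
structure Le (m m' : Search S) : Prop where
  awin : m.awin ⊆ m'.awin
  ewin : m.ewin ⊆ m'.ewin
  edges : m.edges ⊆ m'.edges

theorem Le.refl (m : Search S) : m.Le m := ⟨subset_rfl, subset_rfl, subset_rfl⟩

theorem Le.trans {m₁ m₂ m₃ : Search S} (h : m₁.Le m₂) (h' : m₂.Le m₃) : m₁.Le m₃ :=
  ⟨h.awin.trans h'.awin, h.ewin.trans h'.ewin, h.edges.trans h'.edges⟩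

theorem le_setAwin (s : S) (m : Search S) : m.Le (m.setAwin s) :=
  ⟨Set.subset_insert _ _, subset_rfl, subset_rfl⟩

theorem le_setEwin (s : S) (m : Search S) : m.Le (m.setEwin s) :=
  ⟨subset_rfl, Set.subset_insert _ _, subset_rfl⟩

/-- The memory `m'` arises from `m` by exploring only states that are new for `m`. -/
structure Extends (m m' : Search S) : Prop extends m.Le m' where
  discovered : m.discovered ⊆ m'.discovered
  edges_old : ∀ x y, (x, y) ∈ m'.edges → x ∈ m.discovered → (x, y) ∈ m.edges
  index_old : ∀ x ∈ m.discovered, m'.index x = m.index x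
  count_le : m.count ≤ m'.count
  index_new : ∀ x ∈ m'.discovered, x ∉ m.discovered → m.count ≤ m'.index x

theorem Extends.refl (m : Search S) : m.Extends m :=
  ⟨.refl m, subset_rfl, fun _ _ h _ => h, fun _ _ => rfl, le_rfl, fun _ h h' => absurd h h'⟩

theorem Extends.trans {m₁ m₂ m₃ : Search S} (h : m₁.Extends m₂) (h' : m₂.Extends m₃) :
    m₁.Extends m₃ where
  toLe := h.toLe.trans h'.toLe
  discovered := h.discovered.trans h'.discovered
  edges_old x y hxy hx := h.edges_old x y (h'.edges_old x y hxy (h.discovered hx)) hx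
  index_old x hx := (h'.index_old x (h.discovered hx)).trans (h.index_old x hx)
  count_le := h.count_le.trans h'.count_le
  index_new x hx hx' := by
    by_cases hx₂ : x ∈ m₂.discovered
    · rw [h'.index_old x hx₂]
      exact h.index_new x hx₂ hx'
    · exact h.count_le.trans (h'.index_new x hx hx₂)

end Search

section Dfs

variable {G : Game 𝒳 𝒴} {skip : G.State → Set (Set 𝒴)}

/-- The agent choice `Y` at `s` has been refuted, or all its successors have been visited. -/
def Explored (G : Game 𝒳 𝒴) (m : Search G.State) (s : G.State) (Y : Set 𝒴) : Prop :=
  (∃ X : Set 𝒳, G.move s X Y ∈ m.ewin) ∨ ∀ X : Set 𝒳, (s, G.move s X Y) ∈ m.edges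

theorem Explored.mono {m m' : Search G.State} (h : m.Le m') {s : G.State} {Y : Set 𝒴} :
    Explored G m s Y → Explored G m' s Y :=
  Or.imp (fun ⟨X, hX⟩ => ⟨X, h.ewin hX⟩) fun h' X => h.edges (h' X)

variable (G skip) in
/-- The invariant of the search, where `st` is the set of states whose exploration is not yet
completed. -/
structure SearchInv (st : Set G.State) (m : Search G.State) : Prop where
  stack_subset : st ⊆ m.discovered
  index_lt : ∀ x ∈ m.discovered, m.index x < m.count
  edge_source : ∀ x y, (x, y) ∈ m.edges → x ∈ m.discovered
  -- Open states are exempt: an edge is recorded before the call that visits its target.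
  edge_target : ∀ x y, (x, y) ∈ m.edges → x ∉ st → y ∈ m.discovered
  awin_sound : m.awin ⊆ G.solve
  accept_awin : ∀ x ∈ m.discovered, x ∈ G.dfa.accept → x ∈ m.awin
  ewin_trap : ∀ x ∈ m.ewin,
    x ∉ G.dfa.accept ∧ ∀ Y, Y ∉ skip x → ∃ X : Set 𝒳, G.move x X Y ∈ m.ewin
  explored : ∀ x ∈ m.discovered, x ∉ st → ∀ Y, Y ∉ skip x → Explored G m x Y
  -- The core of the Tarjan argument: a completed state stays undetermined only while it can still
  -- lead back to the stack.
  undetermined_reaches : ∀ x ∈ m.undetermined, x ∉ st → ∃ a ∈ st, m.Reaches x a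

variable (G skip) in
/-- The invariant during the exploration of `s`, which was started with memory `m₀` and set
`st` of open states. -/
structure Frame (m₀ : Search G.State) (st : Set G.State) (s : G.State) (m : Search G.State) :
    Prop where
  inv : SearchInv G skip (insert s st) m
  ext : m₀.Extends m
  notMem : s ∉ m₀.discovered
  mem : s ∈ m.discovered
  index : m.index s = m₀.count
  targets : ∀ y, (s, y) ∈ m.edges → y ∈ m.discovered
  reaches_new : ∀ x ∈ m.discovered, x ∉ m₀.discovered → m.Reaches s x
  reaches_of_stack : ∀ a ∈ st, m.Reaches a s

variable (G skip) in
/-- What a call of the search at `s` with memory `m` achieves. -/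
structure CallPost (st : Set G.State) (s : G.State) (m m' : Search G.State) : Prop where
  inv : SearchInv G skip st m'
  ext : m.Extends m'
  mem : s ∈ m'.discovered
  reaches_new : ∀ x ∈ m'.discovered, x ∉ m.discovered → m'.Reaches s x

variable (G skip) in
/-- Correctness of the calls at states that are reached after `m₀`. -/
def CallSpec (call : G.State → Search G.State → Option (Search G.State)) (m₀ : Search G.State) :
    Prop :=
  ∀ st t m, m₀.discovered ⊂ m.discovered → SearchInv G skip st m → (∀ a ∈ st, m.Reaches a t) →
    ∃ m', call t m = some m' ∧ CallPost G skip st t m m'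

/-! ### Preservation of the invariants while a state is explored -/

theorem SearchInv.addEdge {st : Set G.State} {m : Search G.State} (h : SearchInv G skip st m)
    {s : G.State} (hs : s ∈ st) (t : G.State) : SearchInv G skip st (m.addEdge s t) where
  stack_subset := h.stack_subset
  index_lt := h.index_lt
  edge_source := by
    rintro x y (hxy | hxy)
    · cases hxy
      exact h.stack_subset hs
    · exact h.edge_source x y hxy
  edge_target := by
    rintro x y (hxy | hxy) hx
    · cases hxy
      exact absurd hs hx
    · exact h.edge_target x y hxy hx
  awin_sound := h.awin_sound
  accept_awin := h.accept_awin
  ewin_trap := h.ewin_trap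
  explored x hx hx' Y hY := (h.explored x hx hx' Y hY).imp id fun h' X => Or.inr (h' X)
  undetermined_reaches x hx hx' := by
    obtain ⟨a, ha, hxa⟩ := h.undetermined_reaches x hx hx'
    exact ⟨a, ha, hxa.mono (Set.subset_insert _ _)⟩

theorem SearchInv.frame_discover {st : Set G.State} {m : Search G.State}
    (h : SearchInv G skip st m) {s : G.State} (hs : s ∉ m.discovered)
    (hst : ∀ a ∈ st, m.Reaches a s) :
    Frame G skip m st s (m.discover s (s ∈ G.dfa.accept)) := by
  have hd := Search.discovered_discover s (s ∈ G.dfa.accept) m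
  have hidx : ∀ x ∈ m.discovered, (m.discover s (s ∈ G.dfa.accept)).index x = m.index x := by
    intro x hx
    have hne : x ≠ s := fun e => hs (e ▸ hx)
    simp [Search.discover, hne]
  have hidx' : (m.discover s (s ∈ G.dfa.accept)).index s = m.count := by
    simp [Search.discover]
  have hle : m.Le (m.discover s (s ∈ G.dfa.accept)) := by
    refine ⟨?_, subset_rfl, subset_rfl⟩
    simp only [Search.discover]
    split_ifs
    · exact Set.subset_insert _ _
    · exact subset_rfl
  refine ⟨⟨?_, ?_, ?_, ?_, ?_, ?_, ?_, ?_, ?_⟩, ⟨hle, ?_, ?_, hidx, ?_, ?_⟩, hs, ?_, hidx', ?_,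
    ?_, hst⟩
  · rw [hd]
    exact Set.insert_subset_insert h.stack_subset
  · rw [hd]
    rintro x (rfl | hx)
    · rw [hidx']
      exact Nat.lt_succ_self _
    · rw [hidx x hx]
      exact (h.index_lt x hx).trans (Nat.lt_succ_self _)
  · rw [hd]
    exact fun x y hxy => Or.inr (h.edge_source x y hxy)
  · rw [hd]
    exact fun x y hxy hx => Or.inr (h.edge_target x y hxy fun hx' => hx (Or.inr hx'))
  · simp only [Search.discover]
    split_ifs with hacc
    · exact Set.insert_subset (G.accept_subset_solve hacc) h.awin_sound
    · exact h.awin_sound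
  · rw [hd]
    rintro x (rfl | hx) hacc
    · simp [Search.discover, hacc]
    · exact hle.awin (h.accept_awin x hx hacc)
  · exact h.ewin_trap
  · rw [hd]
    rintro x (rfl | hx) hx' Y hY
    · exact absurd (Or.inl rfl) hx'
    · exact (h.explored x hx (fun hx'' => hx' (Or.inr hx'')) Y hY).mono hle
  · rintro x (rfl | hx) hx'
    · exact absurd (Or.inl rfl) hx'
    · obtain ⟨a, ha, hxa⟩ := h.undetermined_reaches x hx fun hx'' => hx' (Or.inr hx'')
      exact ⟨a, Or.inr ha, hxa⟩
  · rw [hd]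
    exact Set.subset_insert _ _
  · exact fun x y hxy _ => hxy
  · exact Nat.le_succ _
  · rw [hd]
    rintro x (rfl | hx) hx'
    · rw [hidx']
    · exact absurd hx hx'
  · rw [hd]
    exact Or.inl rfl
  · exact fun y hy => absurd (h.edge_source _ _ hy) hs
  · rw [hd]
    rintro x (rfl | hx) hx'
    · exact .refl
    · exact absurd hx hx'

theorem Frame.ssubset {m₀ m : Search G.State} {st : Set G.State} {s : G.State}
    (h : Frame G skip m₀ st s m) : m₀.discovered ⊂ m.discovered :=
  Set.ssubset_iff_of_subset h.ext.discovered |>.2 ⟨s, h.mem, h.notMem⟩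

/-- The edge to `t` is added first, so all open states, including `s`, reach `t`, as the call
requires. Afterwards `t` is visited, which restores the condition on the targets of `s`. -/
theorem Frame.call {call : G.State → Search G.State → Option (Search G.State)}
    {m₀ m : Search G.State} {st : Set G.State} {s : G.State} (hcall : CallSpec G skip call m₀)
    (h : Frame G skip m₀ st s m) (t : G.State) :
    ∃ m', call t (m.addEdge s t) = some m' ∧ Frame G skip m₀ st s m' ∧ m.Le m' ∧
      t ∈ m'.discovered ∧ (s, t) ∈ m'.edges := by
  have hedge : (s, t) ∈ (m.addEdge s t).edges := Set.mem_insert _ _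
  have hsub : m.edges ⊆ (m.addEdge s t).edges := Set.subset_insert _ _
  have hle : m.Le (m.addEdge s t) := ⟨subset_rfl, subset_rfl, hsub⟩
  have hreach : ∀ a ∈ insert s st, (m.addEdge s t).Reaches a t := by
    rintro a (rfl | ha)
    · exact .single hedge
    · exact ((h.reaches_of_stack a ha).mono hsub).tail hedge
  obtain ⟨m', h1, h2⟩ := hcall _ t (m.addEdge s t) h.ssubset
    (h.inv.addEdge (Set.mem_insert _ _) t) hreach
  have hext : m₀.Extends (m.addEdge s t) :=
    { toLe := h.ext.toLe.trans hle
      discovered := h.ext.discovered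
      edges_old := by
        rintro x y (hxy | hxy) hx
        · cases hxy
          exact absurd hx h.notMem
        · exact h.ext.edges_old x y hxy hx
      index_old := h.ext.index_old
      count_le := h.ext.count_le
      index_new := h.ext.index_new }
  refine ⟨m', h1, ⟨h2.inv, hext.trans h2.ext, h.notMem, h2.ext.discovered h.mem, ?_, ?_, ?_, ?_⟩,
    hle.trans h2.ext.toLe, h2.mem, h2.ext.edges hedge⟩
  · exact (h2.ext.index_old s h.mem).trans h.index
  · intro y hy
    rcases h2.ext.edges_old s y hy h.mem with hy' | hy'
    · cases hy'
      exact h2.mem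
    · exact h2.ext.discovered (h.targets y hy')
  · intro x hx hx'
    -- States found by this call are reached from `t`, hence from `s` along the new edge.
    by_cases hxm : x ∈ m.discovered
    · exact ((h.reaches_new x hxm hx').mono hsub).mono h2.ext.edges
    · exact (h2.reaches_new x hx hxm).head (h2.ext.edges hedge)
  · exact fun a ha => ((h.reaches_of_stack a ha).mono hsub).mono h2.ext.edges

theorem Frame.loopX {call : G.State → Search G.State → Option (Search G.State)}
    {m₀ : Search G.State} {st : Set G.State} {s : G.State} (hcall : CallSpec G skip call m₀)
    (Y : Set 𝒴) (Xs : List (Set 𝒳)) :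
    ∀ (undet : Bool) (m : Search G.State), Frame G skip m₀ st s m →
    ∃ m' e u, CompSynth.loopX G call s Y Xs undet m = some (m', e, u) ∧ Frame G skip m₀ st s m' ∧
      m.Le m' ∧ (e = true → ∃ X : Set 𝒳, G.move s X Y ∈ m'.ewin) ∧
      (e = false → ∀ X ∈ Xs, (s, G.move s X Y) ∈ m'.edges) ∧
      (u = false → undet = false) ∧
      (e = false → u = false → ∀ X ∈ Xs, G.move s X Y ∈ m'.awin) := by
  induction Xs with
  | nil => exact fun undet m h => ⟨m, false, undet, rfl, h, .refl m, by simp⟩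
  | cons X Xs ih =>
    intro undet m h
    obtain ⟨m₁, h1, h2, h3, h4, h5⟩ := h.call hcall (G.move s X Y)
    simp only [CompSynth.loopX, h1, Option.bind_some]
    split_ifs with he hu
    · exact ⟨m₁, true, undet, rfl, h2, h3, fun _ => ⟨X, he⟩, by simp⟩
    · obtain ⟨m', e, u, g1, g2, g3, g4, g5, g6, g7⟩ := ih true m₁ h2
      refine ⟨m', e, u, g1, g2, h3.trans g3, g4, fun hee => ?_, fun hu' => ?_, fun _ hu' => ?_⟩
      · exact List.forall_mem_cons.2 ⟨g3.edges h5, g5 hee⟩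
      · cases g6 hu'
      · cases g6 hu'
    · obtain ⟨m', e, u, g1, g2, g3, g4, g5, g6, g7⟩ := ih undet m₁ h2
      refine ⟨m', e, u, g1, g2, h3.trans g3, g4, fun hee => ?_, g6, fun hee huu => ?_⟩
      · exact List.forall_mem_cons.2 ⟨g3.edges h5, g5 hee⟩
      -- A visited successor that is neither environment-winning nor undetermined is known to be
      -- agent-winning, and this persists in later memories.
      · exact List.forall_mem_cons.2 ⟨g3.awin ((h4.resolve_right hu).resolve_right he), g7 hee huu⟩

/-- Common to `setAwin` and `setEwin`: only the classification of visited states changes, so what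
remains to check is that the new classification is sound. -/
theorem Frame.update {m₀ m m' : Search G.State} {st : Set G.State} {s : G.State}
    (h : Frame G skip m₀ st s m) (hd : m'.discovered = m.discovered) (hle : m.Le m')
    (hedges : m'.edges = m.edges) (hindex : m'.index = m.index) (hcount : m'.count = m.count)
    (hundet : m'.undetermined ⊆ m.undetermined) (hawin : m'.awin ⊆ G.solve)
    (hewin : ∀ x ∈ m'.ewin,
      x ∉ G.dfa.accept ∧ ∀ Y, Y ∉ skip x → ∃ X : Set 𝒳, G.move x X Y ∈ m'.ewin) :
    Frame G skip m₀ st s m' := by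
  have hr : ∀ {x y}, m.Reaches x y → m'.Reaches x y := fun hxy => hxy.mono hle.edges
  obtain ⟨⟨a1, a2, a3, a4, a5, a6, a7, a8, a9⟩, b, c1, c2, c3, c4, c5, c6⟩ := h
  rw [← hd] at a1 a2 a3 a4 a6 a8 c2 c4 c5
  rw [← hedges] at a3 a4 c4
  rw [← hindex] at a2 c3
  rw [← hcount] at a2
  refine ⟨⟨a1, a2, a3, a4, hawin, fun x hx hx' => hle.awin (a6 x hx hx'), hewin,
    fun x hx hx' Y hY => (a8 x hx hx' Y hY).mono hle, fun x hx hx' => ?_⟩,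
    ⟨b.toLe.trans hle, ?_, ?_, ?_, ?_, ?_⟩, c1, c2, c3, c4, fun x hx hx' => hr (c5 x hx hx'),
    fun a ha => hr (c6 a ha)⟩
  · obtain ⟨a, ha, hxa⟩ := a9 x (hundet hx) hx'
    exact ⟨a, ha, hr hxa⟩
  · rw [hd]; exact b.discovered
  · rw [hedges]; exact b.edges_old
  · rw [hindex]; exact b.index_old
  · rw [hcount]; exact b.count_le
  · rw [hd, hindex]; exact b.index_new

theorem Frame.setAwin {m₀ m : Search G.State} {st : Set G.State} {s : G.State}
    (h : Frame G skip m₀ st s m) (hs : s ∈ G.solve) : Frame G skip m₀ st s (m.setAwin s) :=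
  h.update (Search.discovered_setAwin h.mem) (Search.le_setAwin s m) rfl rfl rfl
    Set.sdiff_subset (Set.insert_subset hs h.inv.awin_sound) h.inv.ewin_trap

theorem Frame.setEwin {m₀ m : Search G.State} {st : Set G.State} {s : G.State}
    (h : Frame G skip m₀ st s m) (hacc : s ∉ m.awin)
    (hs : ∀ Y, Y ∉ skip s → ∃ X : Set 𝒳, G.move s X Y ∈ m.ewin) :
    Frame G skip m₀ st s (m.setEwin s) := by
  refine h.update (Search.discovered_setEwin h.mem) (Search.le_setEwin s m) rfl rfl rfl
    Set.sdiff_subset h.inv.awin_sound ?_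
  rintro x (rfl | hx)
  · exact ⟨fun hx => hacc (h.inv.accept_awin x h.mem hx),
      fun Y hY => (hs Y hY).imp fun X hX => Or.inr hX⟩
  · obtain ⟨h1, h2⟩ := h.inv.ewin_trap x hx
    exact ⟨h1, fun Y hY => (h2 Y hY).imp fun X hX => Or.inr hX⟩

theorem Frame.loopY [Finite 𝒳] {call : G.State → Search G.State → Option (Search G.State)}
    {m₀ : Search G.State} {st : Set G.State} {s : G.State} (hcall : CallSpec G skip call m₀)
    {Xs : List (Set 𝒳)} (hXs : ∀ X : Set 𝒳, X ∈ Xs) (Ys : List (Set 𝒴)) :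
    ∀ (ewinAll : Bool) (m : Search G.State), Frame G skip m₀ st s m →
    ∃ m' e, CompSynth.loopY G call Xs s Ys ewinAll m = some (m', e) ∧
      Frame G skip m₀ st s m' ∧ m.Le m' ∧ (∀ Y ∈ Ys, Explored G m' s Y) ∧
      (e = true → ewinAll = true ∧ ∀ Y ∈ Ys, ∃ X : Set 𝒳, G.move s X Y ∈ m'.ewin) := by
  induction Ys with
  | nil => exact fun e m h => ⟨m, e, rfl, h, .refl m, by simp⟩
  | cons Y Ys ih =>
    intro ewinAll m h
    obtain ⟨m₁, e, u, h1, h2, h3, h4, h5, -, h7⟩ := Frame.loopX hcall Y Xs false m h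
    simp only [CompSynth.loopY, h1, Option.bind_some]
    match e, u, h4, h5, h7 with
    | true, _, h4, _, _ =>
      obtain ⟨X, hX⟩ := h4 rfl
      obtain ⟨m', e', g1, g2, g3, g4, g5⟩ := ih ewinAll m₁ h2
      exact ⟨m', e', g1, g2, h3.trans g3,
        List.forall_mem_cons.2 ⟨Or.inl ⟨X, g3.ewin hX⟩, g4⟩,
        fun he => ⟨(g5 he).1, List.forall_mem_cons.2 ⟨⟨X, g3.ewin hX⟩, (g5 he).2⟩⟩⟩
    | false, true, _, h5, _ =>
      obtain ⟨m', e', g1, g2, g3, g4, g5⟩ := ih false m₁ h2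
      exact ⟨m', e', g1, g2, h3.trans g3,
        List.forall_mem_cons.2 ⟨Or.inr fun X => g3.edges (h5 rfl X (hXs X)), g4⟩,
        fun he => absurd (g5 he).1 (by simp)⟩
    | false, false, _, h5, h7 =>
      have hs : s ∈ G.solve := G.mem_solve_of_forall Y fun X =>
        h2.inv.awin_sound (h7 rfl rfl X (hXs X))
      obtain ⟨m', e', g1, g2, g3, g4, g5⟩ := ih false (m₁.setAwin s) (h2.setAwin hs)
      exact ⟨m', e', g1, g2, (h3.trans (Search.le_setAwin s m₁)).trans g3,
        List.forall_mem_cons.2 ⟨Or.inr fun X => g3.edges (h5 rfl X (hXs X)), g4⟩,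
        fun he => absurd (g5 he).1 (by simp)⟩

/-! ### Completion of strongly connected components -/

/-- A path from an old state to a new one passes through an open state. -/
theorem Frame.exists_stack_of_reaches {m₀ m : Search G.State} {st : Set G.State} {s x : G.State}
    (h₀ : SearchInv G skip st m₀) (h : Frame G skip m₀ st s m) (hx : x ∈ m₀.discovered)
    (hr : m.Reaches x s) : ∃ a ∈ st, m.Reaches x a := by
  induction hr using Relation.ReflTransGen.head_induction_on with
  | refl => exact absurd hx h.notMem
  | @head x y hxy _ ih =>
    by_cases hxst : x ∈ st
    · exact ⟨x, hxst, .refl⟩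
    · have hy := h₀.edge_target x y (h.ext.edges_old x y hxy hx) hxst
      obtain ⟨a, ha, hya⟩ := ih hy
      exact ⟨a, ha, hya.head hxy⟩

theorem SearchInv.source_mem_discovered {st : Set G.State} {m : Search G.State}
    (h : SearchInv G skip st m) {s t : G.State} (ht : t ∈ m.discovered) (hr : m.Reaches s t) :
    s ∈ m.discovered := by
  rcases hr.cases_head with rfl | ⟨y, hy, -⟩
  · exact ht
  · exact h.edge_source _ _ hy

/-- A state of the component with smaller index than `s` was visited before `s`. The path from it to
`s` meets an open state of `st`, so `s` reaches `st`, and so does everything undetermined that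
reaches `s`. -/
theorem Frame.post_of_not_isSccRoot {m₀ m : Search G.State} {st : Set G.State} {s : G.State}
    (h₀ : SearchInv G skip st m₀) (h : Frame G skip m₀ st s m)
    (hexp : ∀ Y, Y ∉ skip s → Explored G m s Y) (hroot : ¬ m.IsSccRoot s) :
    CallPost G skip st s m₀ m := by
  have hsst : ∃ a ∈ st, m.Reaches s a := by
    simp only [Search.IsSccRoot, not_forall, not_le] at hroot
    obtain ⟨t, ⟨ht1, ht2⟩, hlt⟩ := hroot
    rw [h.index] at hlt
    have ht : t ∈ m₀.discovered := by
      by_contra ht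
      exact absurd (h.ext.index_new t (h.inv.source_mem_discovered h.mem ht2) ht) (by omega)
    obtain ⟨a, ha, hta⟩ := h.exists_stack_of_reaches h₀ ht ht2
    exact ⟨a, ha, ht1.trans hta⟩
  refine ⟨⟨(Set.subset_insert _ _).trans h.inv.stack_subset, h.inv.index_lt, h.inv.edge_source,
    ?_, h.inv.awin_sound, h.inv.accept_awin, h.inv.ewin_trap, ?_, ?_⟩, h.ext, h.mem,
    h.reaches_new⟩
  · intro x y hxy hx
    by_cases hxs : x = s
    · subst hxs
      exact h.targets y hxy
    · exact h.inv.edge_target x y hxy (by simp [hxs, hx])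
  · intro x hx hx' Y hY
    by_cases hxs : x = s
    · subst hxs
      exact hexp Y hY
    · exact h.inv.explored x hx (by simp [hxs, hx']) Y hY
  · intro x hx hx'
    by_cases hxs : x = s
    · subst hxs
      exact hsst
    · obtain ⟨a, rfl | ha, hxa⟩ := h.inv.undetermined_reaches x hx (by simp [hxs, hx'])
      · obtain ⟨b, hb, hab⟩ := hsst
        exact ⟨b, hb, hxa.trans hab⟩
      · exact ⟨a, ha, hxa⟩

theorem discovered_backwardSearch (scc : Set G.State) (m : Search G.State) :
    (backwardSearch G skip scc m).discovered = m.discovered := by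
  ext x
  simp only [Search.discovered, backwardSearch, Set.mem_union, Set.mem_ofPred_eq, Set.mem_sdiff]
  constructor
  · rintro ((h | h | h) | h)
    · cases h with
      | known h => exact Or.inl (Or.inl h)
      | step _ h _ _ => exact Or.inr h
    · exact Or.inl (Or.inr h)
    · exact Or.inr h.2.1
    · exact Or.inr h.1
  · rintro ((h | h) | h)
    · exact Or.inl (Or.inl (.known h))
    · exact Or.inl (Or.inr (Or.inl h))
    · by_cases hscc : x ∈ scc
      · by_cases hb : BackwardWin G skip scc m x
        · exact Or.inl (Or.inl hb)
        · exact Or.inl (Or.inr (Or.inr ⟨hscc, h, hb⟩))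
      · exact Or.inr ⟨h, hscc⟩

theorem le_backwardSearch (scc : Set G.State) (m : Search G.State) :
    m.Le (backwardSearch G skip scc m) :=
  ⟨fun _ h => .known h, Set.subset_union_left, subset_rfl⟩

/-- At a root the component consists of new states only, so none of them lies in `st` and all their
choices are explored. The states that propagation leaves over can be kept by the environment among
themselves and the known environment-winning states. -/
theorem Frame.post_backwardSearch [Finite 𝒳] {m₀ m : Search G.State} {st : Set G.State}
    {s : G.State} (h₀ : SearchInv G skip st m₀) (h : Frame G skip m₀ st s m)
    (hexp : ∀ Y, Y ∉ skip s → Explored G m s Y) (hroot : m.IsSccRoot s) :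
    CallPost G skip st s m₀ (backwardSearch G skip (m.getScc s) m) := by
  have hnew : ∀ x ∈ m.getScc s, x ∉ m₀.discovered := by
    intro x hx hx₀
    have h1 := hroot x hx
    rw [h.index, h.ext.index_old x hx₀] at h1
    exact absurd (h₀.index_lt x hx₀) (by omega)
  have hexp' : ∀ x ∈ m.discovered, x ∉ st → ∀ Y, Y ∉ skip x → Explored G m x Y := by
    intro x hx hx' Y hY
    by_cases hxs : x = s
    · subst hxs
      exact hexp Y hY
    · exact h.inv.explored x hx (by simp [hxs, hx']) Y hY
  have htgt : ∀ x y, (x, y) ∈ m.edges → x ∉ st → y ∈ m.discovered := by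
    intro x y hxy hx
    by_cases hxs : x = s
    · subst hxs
      exact h.targets y hxy
    · exact h.inv.edge_target x y hxy (by simp [hxs, hx])
  -- An undetermined successor reaches an open state, and every open state reaches `s`, which closes
  -- the cycle.
  have hscc : ∀ x ∈ m.getScc s, ∀ y ∈ m.undetermined, (x, y) ∈ m.edges → y ∈ m.getScc s := by
    intro x hx y hy hxy
    refine ⟨hx.1.tail hxy, ?_⟩
    have hstack : ∃ a ∈ insert s st, m.Reaches y a := by
      by_cases hyst : y ∈ insert s st
      · exact ⟨y, hyst, .refl⟩
      · exact h.inv.undetermined_reaches y hy hyst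
    obtain ⟨a, rfl | ha, hya⟩ := hstack
    · exact hya
    · exact hya.trans (h.reaches_of_stack a ha)
  have hle := le_backwardSearch (skip := skip) (m.getScc s) m
  have hd := discovered_backwardSearch (skip := skip) (m.getScc s) m
  refine ⟨⟨?_, ?_, ?_, ?_, ?_, ?_, ?_, ?_, ?_⟩, ⟨h.ext.toLe.trans hle, ?_, h.ext.edges_old,
    h.ext.index_old, h.ext.count_le, ?_⟩, ?_, ?_⟩
  · rw [hd]
    exact (Set.subset_insert _ _).trans h.inv.stack_subset
  · rw [hd]
    exact h.inv.index_lt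
  · rw [hd]
    exact h.inv.edge_source
  · rw [hd]
    exact htgt
  · intro x hx
    have hx' : BackwardWin G skip (m.getScc s) m x := hx
    clear hx
    induction hx' with
    | known hx => exact h.inv.awin_sound hx
    | @step x Y _ _ _ hall ih => exact G.mem_solve_of_forall Y ih
  · rw [hd]
    exact fun x hx hx' => hle.awin (h.inv.accept_awin x hx hx')
  · rintro x (hx | ⟨hx1, hx2, hx3⟩)
    · obtain ⟨h1, h2⟩ := h.inv.ewin_trap x hx
      exact ⟨h1, fun Y hY => (h2 Y hY).imp fun X hX => hle.ewin hX⟩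
    · have hxd : x ∈ m.discovered := Or.inr hx2
      have hxst : x ∉ st := fun hx => hnew x hx1 (h₀.stack_subset hx)
      refine ⟨fun hacc => hx3 (.known (h.inv.accept_awin x hxd hacc)), fun Y hY => ?_⟩
      rcases hexp' x hxd hxst Y hY with ⟨X, hX⟩ | hall
      · exact ⟨X, hle.ewin hX⟩
      · have hex : ∃ X : Set 𝒳, ¬ BackwardWin G skip (m.getScc s) m (G.move x X Y) := by
          by_contra! hno
          exact hx3 (.step hx1 hx2 hY hno)
        obtain ⟨X, hX⟩ := hex
        refine ⟨X, ?_⟩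
        rcases htgt x _ (hall X) hxst with (hu | hu) | hu
        · exact absurd (.known hu) hX
        · exact hle.ewin hu
        · exact Or.inr ⟨hscc x hx1 _ hu (hall X), hu, hX⟩
  · rw [hd]
    exact fun x hx hx' Y hY => (hexp' x hx hx' Y hY).mono hle
  · rintro x ⟨hx, hxscc⟩ hxst
    change ∃ a ∈ st, m.Reaches x a
    have hxs : x ≠ s := by
      rintro rfl
      exact hxscc ⟨.refl, .refl⟩
    obtain ⟨a, rfl | ha, hxa⟩ := h.inv.undetermined_reaches x hx (by simp [hxs, hxst])
    -- An undetermined state that reaches `s` from outside the component must be old, because all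
    -- new states are reachable from `s`.
    · by_cases hx₀ : x ∈ m₀.discovered
      · exact h.exists_stack_of_reaches h₀ hx₀ hxa
      · exact absurd ⟨h.reaches_new x (Or.inr hx) hx₀, hxa⟩ hxscc
    · exact ⟨a, ha, hxa⟩
  · rw [hd]
    exact h.ext.discovered
  · rw [hd]
    exact h.ext.index_new
  · rw [hd]
    exact h.mem
  · rw [hd]
    exact h.reaches_new

theorem dfSearch_spec [Finite 𝒳] {Xs : List (Set 𝒳)} (hXs : ∀ X : Set 𝒳, X ∈ Xs)
    {Ys : List (Set 𝒴)} (hYs : ∀ Y : Set 𝒴, Y ∈ Ys) (depth : ℕ) :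
    ∀ (st : Set G.State) (s : G.State) (m : Search G.State), m.discoveredᶜ.ncard < depth →
      SearchInv G skip st m → (∀ a ∈ st, m.Reaches a s) →
      ∃ m', dfSearch G skip Xs Ys depth s m = some m' ∧ CallPost G skip st s m m' := by
  have := G.finite
  induction depth with
  | zero => exact fun _ _ _ h => absurd h (Nat.not_lt_zero _)
  | succ depth ih =>
    intro st s m hcard h₀ hst
    by_cases hs : s ∈ m.discovered
    · exact ⟨m, if_pos hs, h₀, .refl m, hs, fun x hx hx' => absurd hx hx'⟩
    · have hcall : CallSpec G skip (dfSearch G skip Xs Ys depth) m := by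
        intro st' t m' hlt
        refine ih st' t m' (lt_of_lt_of_le (Set.ncard_lt_ncard ?_) (Nat.le_of_lt_succ hcard))
        exact compl_lt_compl_iff_lt.2 hlt
      obtain ⟨m₁, e, h1, h2, -, h4, h5⟩ := Frame.loopY hcall hXs
        (Ys.filter fun Y => decide (Y ∉ skip s)) true _ (h₀.frame_discover hs hst)
      have hmem : ∀ Y, Y ∉ skip s → Y ∈ Ys.filter fun Y => decide (Y ∉ skip s) :=
        fun Y hY => List.mem_filter.2 ⟨hYs Y, by simpa using hY⟩
      set m₂ := if e = true ∧ s ∉ m₁.awin then m₁.setEwin s else m₁ with hm₂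
      have hframe : Frame G skip m st s m₂ ∧ m₁.Le m₂ := by
        rw [hm₂]
        split_ifs with he
        · exact ⟨h2.setEwin he.2 fun Y hY => (h5 he.1).2 Y (hmem Y hY), Search.le_setEwin s m₁⟩
        · exact ⟨h2, .refl _⟩
      have hexp : ∀ Y, Y ∉ skip s → Explored G m₂ s Y :=
        fun Y hY => (h4 Y (hmem Y hY)).mono hframe.2
      refine ⟨if m₂.IsSccRoot s then backwardSearch G skip (m₂.getScc s) m₂ else m₂, ?_, ?_⟩
      · refine (if_neg hs).trans ?_
        rw [h1]
        rfl
      · split_ifs with hroot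
        · exact hframe.1.post_backwardSearch h₀ hexp hroot
        · exact hframe.1.post_of_not_isSccRoot h₀ hexp hroot

variable (G skip) in
theorem searchInv_empty : SearchInv G skip ∅ Search.empty := by
  constructor <;> simp [Search.empty, Search.discovered]

end Dfs

/-! ### From the search to the agent-winning region -/

/-- What the computation of an agent-winning region for the language `L` yields: `none` if the
agent cannot win, otherwise a region for the safe part of `L`. -/
def IsAwrAnswer (L : Language (Set (𝒳 ⊕ 𝒴))) : Option (Region 𝒳 𝒴) → Prop
  | none => ¬ AgentWins L []
  | some R => AgentWins L [] ∧ R.EwDead ∧ ∀ w, w ∈ R.dfa.accepts ↔ w ∈ L ∧ Safe L w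

theorem isAwrAnswer_buildAwr [Finite 𝒳] {G : Game 𝒳 𝒴} {W : Set G.State}
    (hW : IsWinningCore G W) (h0 : G.dfa.start ∈ W) :
    IsAwrAnswer G.dfa.accepts (some (buildAwr G W h0).minimize) := by
  refine ⟨G.start_mem_solve_iff.1 (hW.sound h0), (Region.ewDead_buildAwr G W h0).minimize, fun w => ?_⟩
  rw [Region.accepts_minimize]
  exact mem_accepts_buildAwr hW h0

/-- With no open states left, no visited state is undetermined. The set `m.ewin` is a trap up to
skipped choices, which are lost anyway, so `m.awin` consists of exactly the visited winning states.
A choice certain to win is neither skipped nor refuted, so all its successors were visited, and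
`m.awin` is a winning core. -/
theorem searchAwr_spec [Finite 𝒳] {G : Game 𝒳 𝒴} {skip : G.State → Set (Set 𝒴)}
    (hskip : ∀ s, ∀ Y ∈ skip s, ∃ X : Set 𝒳, G.move s X Y ∉ G.solve)
    {Xs : List (Set 𝒳)} (hXs : ∀ X : Set 𝒳, X ∈ Xs)
    {Ys : List (Set 𝒴)} (hYs : ∀ Y : Set 𝒴, Y ∈ Ys) :
    ∀ᶠ depth in Filter.atTop, ∃ r, searchAwr G skip Xs Ys depth = some r ∧
      IsAwrAnswer G.dfa.accepts r := by
  filter_upwards [Filter.eventually_gt_atTop ((Search.empty : Search G.State).discoveredᶜ.ncard)]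
    with depth hdepth
  obtain ⟨m, h1, h2⟩ := dfSearch_spec (skip := skip) hXs hYs depth ∅ G.dfa.start Search.empty
    hdepth (searchInv_empty G skip) (by simp)
  have hew : ∀ s ∈ m.ewin, s ∉ G.solve := fun s hs => by
    refine G.notMem_solve_of_trap (T := m.ewin) (fun s hs => ?_) hs
    refine ⟨(h2.inv.ewin_trap s hs).1, fun Y => ?_⟩
    by_cases hY : Y ∈ skip s
    · exact (hskip s Y hY).imp fun X hX => Or.inr hX
    · exact ((h2.inv.ewin_trap s hs).2 Y hY).imp fun X hX => Or.inl hX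
  have hdet : ∀ s ∈ m.discovered, s ∈ G.solve → s ∈ m.awin := by
    rintro s ((hs | hs) | hs) hs'
    · exact hs
    · exact absurd hs' (hew s hs)
    · obtain ⟨a, ha, -⟩ := h2.inv.undetermined_reaches s hs (by simp)
      exact absurd ha (by simp)
  have hcore : IsWinningCore G m.awin := by
    refine ⟨h2.inv.awin_sound, fun s hs Y hY X => ?_⟩
    have hYs : Y ∉ skip s := fun hY' => by
      obtain ⟨X, hX⟩ := hskip s Y hY'
      exact hX (hY X)
    rcases h2.inv.explored s (Or.inl (Or.inl hs)) (by simp) Y hYs with ⟨X', hX'⟩ | hall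
    · exact absurd (hY X') (hew _ hX')
    · exact hdet _ (h2.inv.edge_target _ _ (hall X) (by simp)) (hY X)
  refine ⟨_, by rw [searchAwr, h1]; rfl, ?_⟩
  split_ifs with h
  · exact isAwrAnswer_buildAwr hcore h
  · exact fun hwin => h (hdet _ h2.mem (G.start_mem_solve_iff.2 hwin))

/-! ## The answer does not depend on the recursion bound -/

/-- The algorithm is assembled from `bind`s, so independence of the recursion bound passes upwards
through each of its layers by this lemma. -/
theorem bind_eq_some_mono {α β : Type*} {a b : Option α} {f g : α → Option β}
    (hab : ∀ x, a = some x → b = some x) (hfg : ∀ x y, f x = some y → g x = some y) (y : β)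
    (h : a.bind f = some y) : b.bind g = some y := by
  obtain ⟨x, h1, h2⟩ := Option.bind_eq_some_iff.1 h
  exact Option.bind_eq_some_iff.2 ⟨x, hab x h1, hfg x y h2⟩

section Depth

variable {G : Game 𝒳 𝒴} {skip : G.State → Set (Set 𝒴)}

theorem loopX_mono {call call' : G.State → Search G.State → Option (Search G.State)}
    (h : ∀ s m r, call s m = some r → call' s m = some r) (s : G.State) (Y : Set 𝒴)
    (Xs : List (Set 𝒳)) : ∀ (u : Bool) (m : Search G.State) (r : Search G.State × Bool × Bool),
      loopX G call s Y Xs u m = some r → loopX G call' s Y Xs u m = some r := by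
  induction Xs with
  | nil => exact fun _ _ _ hr => hr
  | cons X Xs ih =>
    refine fun u m => bind_eq_some_mono (h _ _) fun m' r hr => ?_
    split_ifs at hr ⊢ with h1 h2
    · exact hr
    · exact ih _ _ _ hr
    · exact ih _ _ _ hr

theorem loopY_mono {call call' : G.State → Search G.State → Option (Search G.State)}
    (h : ∀ s m r, call s m = some r → call' s m = some r) (Xs : List (Set 𝒳)) (s : G.State)
    (Ys : List (Set 𝒴)) : ∀ (e : Bool) (m : Search G.State) (r : Search G.State × Bool),
      loopY G call Xs s Ys e m = some r → loopY G call' Xs s Ys e m = some r := by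
  induction Ys with
  | nil => exact fun _ _ _ hr => hr
  | cons Y Ys ih =>
    refine fun e m => bind_eq_some_mono (loopX_mono h _ _ _ _ _) ?_
    rintro ⟨m', _ | _, _ | _⟩ r hr <;> exact ih _ _ _ hr

theorem dfSearch_mono (Xs : List (Set 𝒳)) (Ys : List (Set 𝒴)) (d : ℕ) :
    ∀ (d' : ℕ), d ≤ d' → ∀ (s : G.State) (m r : Search G.State),
      dfSearch G skip Xs Ys d s m = some r → dfSearch G skip Xs Ys d' s m = some r := by
  induction d with
  | zero => exact fun _ _ _ _ _ h => nomatch h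
  | succ d ih =>
    rintro (_ | d') hd s m r h
    · exact absurd hd (by omega)
    · simp only [dfSearch] at h ⊢
      split_ifs at h ⊢ with hs
      · exact h
      · exact bind_eq_some_mono
          (loopY_mono (ih d' (Nat.le_of_succ_le_succ hd)) _ _ _ _ _) (fun _ _ h => h) r h

theorem searchAwr_mono (Xs : List (Set 𝒳)) (Ys : List (Set 𝒴)) {d d' : ℕ} (hd : d ≤ d')
    (r : Option (Region 𝒳 𝒴)) (h : searchAwr G skip Xs Ys d = some r) :
    searchAwr G skip Xs Ys d' = some r :=
  bind_eq_some_mono (dfSearch_mono Xs Ys d d' hd _ _) (fun _ _ h => h) r h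

end Depth

section Algorithm

variable {Xs : List (Set 𝒳)} {Ys : List (Set 𝒴)}

theorem compose_mono {d d' : ℕ} (hd : d ≤ d') (v : Variant) (R : Region 𝒳 𝒴) (ψ : LTLf (𝒳 ⊕ 𝒴))
    (r : Option (Region 𝒳 𝒴)) (h : compose Xs Ys d v R ψ = some r) :
    compose Xs Ys d' v R ψ = some r := by
  cases v with
  | individual => exact bind_eq_some_mono (searchAwr_mono Xs Ys hd) (fun _ _ h => h) r h
  | incremental => exact searchAwr_mono Xs Ys hd r h

theorem someUnrealizable_mono {d d' : ℕ} (hd : d ≤ d') (φs : List (LTLf (𝒳 ⊕ 𝒴))) :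
    ∀ b, someUnrealizable Xs Ys d φs = some b → someUnrealizable Xs Ys d' φs = some b := by
  induction φs with
  | nil => exact fun _ h => h
  | cons φ φs ih =>
    refine bind_eq_some_mono (searchAwr_mono Xs Ys hd) ?_
    rintro (_ | R) b h
    · exact h
    · exact ih b h

theorem composeAll_mono {d d' : ℕ} (hd : d ≤ d') (v : Variant) (φs : List (LTLf (𝒳 ⊕ 𝒴))) :
    ∀ R r, composeAll Xs Ys d v φs R = some r → composeAll Xs Ys d' v φs R = some r := by
  induction φs with
  | nil => exact fun _ _ h => h
  | cons φ φs ih =>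
    refine fun R => bind_eq_some_mono (compose_mono hd v R φ) ?_
    rintro (_ | R') r h
    · exact h
    · exact ih R' r h

theorem synthesize_mono {d d' : ℕ} (hd : d ≤ d') (v : Variant) (φs : List (LTLf (𝒳 ⊕ 𝒴))) :
    ∀ r, synthesize Xs Ys d v φs = some r → synthesize Xs Ys d' v φs = some r := by
  refine bind_eq_some_mono (someUnrealizable_mono hd φs) ?_
  rintro (_ | _) r h
  · exact bind_eq_some_mono (composeAll_mono hd v φs _) (fun _ _ h => h) r h
  · exact h

/-! ## Correctness of the compositional algorithm -/

/-- The non-empty traces that satisfy `φ`. -/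
def language (φ : LTLf (𝒳 ⊕ 𝒴)) : Language (Set (𝒳 ⊕ 𝒴)) :=
  (Game.ofFormula φ).dfa.accepts

theorem mem_language {φ : LTLf (𝒳 ⊕ 𝒴)} {w : List (Set (𝒳 ⊕ 𝒴))} :
    w ∈ language φ ↔ w ≠ [] ∧ φ.Sat w := LTLf.mem_accepts_dfa φ w

theorem getAwr_spec [Finite 𝒳] (hXs : ∀ X : Set 𝒳, X ∈ Xs) (hYs : ∀ Y : Set 𝒴, Y ∈ Ys)
    (φ : LTLf (𝒳 ⊕ 𝒴)) :
    ∀ᶠ d in Filter.atTop, ∃ r, getAwr Xs Ys d φ = some r ∧ IsAwrAnswer (language φ) r :=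
  searchAwr_spec (fun _ _ hY => absurd hY (Set.notMem_empty _)) hXs hYs

/-- What the composition with a formula of language `L` yields for a region that accepts `K`:
`none` only if the agent cannot win for `K ⊓ L`, and otherwise a region which accepts a part of
`K ⊓ L` that is sufficient for the agent, whatever further conditions are imposed. -/
def IsComposeAnswer (K L : Language (Set (𝒳 ⊕ 𝒴))) : Option (Region 𝒳 𝒴) → Prop
  | none => ¬ AgentWins (K ⊓ L) []
  | some R => R.EwDead ∧ AgentWins R.dfa.accepts [] ∧ (∀ w ∈ R.dfa.accepts, w ∈ K ⊓ L) ∧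
      ∀ N, AgentWins (N ⊓ (K ⊓ L)) [] → AgentWins (N ⊓ R.dfa.accepts) []

/-- `M` is the language of the game actually solved, which may be smaller than `K ⊓ L`. Passing to
its safe part loses nothing by `AgentWins.inter_safe`; in the `none` case the choice `N = K ⊓ L`
applies. -/
theorem IsAwrAnswer.isComposeAnswer {K L M : Language (Set (𝒳 ⊕ 𝒴))} (hM : ∀ w ∈ M, w ∈ K ⊓ L)
    (hwin : ∀ N, AgentWins (N ⊓ (K ⊓ L)) [] → AgentWins (N ⊓ M) []) :
    ∀ {r : Option (Region 𝒳 𝒴)}, IsAwrAnswer M r → IsComposeAnswer K L r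
  | none, h => fun h' => h <|
    ((hwin (K ⊓ L) (h'.mono fun _ hw => And.intro hw hw)).mono fun _ hw => hw.2)
  | some R, ⟨h1, h2, h3⟩ => by
    refine ⟨h2, ?_, fun w hw => hM w ((h3 w).1 hw).1, fun N hN => ?_⟩
    · exact h1.inter_safe (fun _ hw => hw) (fun w hw hs => (h3 w).2 ⟨hw, hs⟩) (safe_nil _)
    · exact (hwin N hN).inter_safe (fun _ hw => hw.2)
        (fun w hw hs => And.intro hw.1 ((h3 w).2 ⟨hw.2, hs⟩)) (safe_nil _)

/-- The variants differ only in the game that is solved: individual composition uses the words of `K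
⊓ L` that are safe for `L`, incremental composition uses `K ⊓ L` itself and skips choices that are
lost because `R.ew` is dead. -/
theorem compose_spec [Finite 𝒳] (hXs : ∀ X : Set 𝒳, X ∈ Xs) (hYs : ∀ Y : Set 𝒴, Y ∈ Ys)
    (v : Variant) {R : Region 𝒳 𝒴} (hR : R.EwDead) (ψ : LTLf (𝒳 ⊕ 𝒴)) :
    ∀ᶠ d in Filter.atTop, ∃ r, compose Xs Ys d v R ψ = some r ∧
      IsComposeAnswer R.dfa.accepts (language ψ) r := by
  cases v with
  | individual =>
    filter_upwards [getAwr_spec hXs hYs ψ] with d hd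
    obtain ⟨r, h1, h2⟩ := hd
    simp only [compose, composeIndividual, h1, Option.bind_some]
    match r, h2 with
    | none, h2 => exact ⟨none, rfl, fun h => h2 (h.mono fun _ hw => hw.2)⟩
    | some R₂, ⟨h2, h3, h4⟩ =>
      refine ⟨_, rfl, ?_⟩
      refine IsAwrAnswer.isComposeAnswer (M := (R.toGame.prod R₂.toGame).dfa.accepts) ?_ ?_ ?_
      · intro w hw
        obtain ⟨h5, h6⟩ := mem_accepts_prod.1 hw
        exact ⟨h5, ((h4 w).1 h6).1⟩
      · intro N hN
        refine hN.inter_safe (L := language ψ) (fun _ hw => hw.2.2) (fun w hw hs => ?_)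
          (safe_nil _)
        exact ⟨hw.1, mem_accepts_prod.2 ⟨hw.2.1, (h4 w).2 ⟨hw.2.2, hs⟩⟩⟩
      · split_ifs with h
        · exact isAwrAnswer_buildAwr (isWinningCore_solve _) h
        · exact fun hwin => h ((Game.start_mem_solve_iff _).2 hwin)
  | incremental =>
    filter_upwards [searchAwr_spec (G := R.toGame.prod (Game.ofFormula ψ))
      (skip := fun s => R.ewinAgentChoices s.1)
      (fun s Y hY => hR.exists_notMem_solve_prod _ hY) hXs hYs] with d hd
    obtain ⟨r, h1, h2⟩ := hd
    refine ⟨r, h1, h2.isComposeAnswer (fun w hw => mem_accepts_prod.1 hw) fun N hN => ?_⟩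
    exact hN.mono fun w hw => And.intro hw.1 (mem_accepts_prod.2 hw.2)

/-- The non-empty traces that satisfy all formulas of a list. -/
def languageAll (φs : List (LTLf (𝒳 ⊕ 𝒴))) : Language (Set (𝒳 ⊕ 𝒴)) :=
  {w | w ≠ [] ∧ ∀ φ ∈ φs, φ.Sat w}

theorem languageAll_cons (φ : LTLf (𝒳 ⊕ 𝒴)) (φs : List (LTLf (𝒳 ⊕ 𝒴)))
    (w : List (Set (𝒳 ⊕ 𝒴))) :
    w ∈ languageAll (φ :: φs) ↔ w ∈ language φ ∧ w ∈ languageAll φs := by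
  have h : ∀ ψs : List (LTLf (𝒳 ⊕ 𝒴)), w ∈ languageAll ψs ↔ w ≠ [] ∧ ∀ ψ ∈ ψs, ψ.Sat w :=
    fun _ => Iff.rfl
  rw [h, h, mem_language, List.forall_mem_cons]
  tauto

theorem sat_bigConj (φs : List (LTLf (𝒳 ⊕ 𝒴))) (w : List (Set (𝒳 ⊕ 𝒴))) :
    (LTLf.bigConj φs).Sat w ↔ ∀ φ ∈ φs, φ.Sat w := by
  match φs with
  | [] => simp [LTLf.bigConj, LTLf.Sat]
  | [φ] => simp [LTLf.bigConj]
  | φ :: ψ :: φs =>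
    rw [LTLf.bigConj, LTLf.Sat, sat_bigConj (ψ :: φs), List.forall_mem_cons (l := ψ :: φs)]

/-- The first loop is only an early exit: a conjunct that cannot be won rules out the conjunction,
while the answer `false` carries no information. -/
theorem someUnrealizable_spec [Finite 𝒳] (hXs : ∀ X : Set 𝒳, X ∈ Xs)
    (hYs : ∀ Y : Set 𝒴, Y ∈ Ys) (φs : List (LTLf (𝒳 ⊕ 𝒴))) :
    ∀ᶠ d in Filter.atTop, ∃ b, someUnrealizable Xs Ys d φs = some b ∧
      (b = true → ¬ AgentWins (languageAll φs) []) := by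
  induction φs with
  | nil => exact Filter.Eventually.of_forall fun d => ⟨false, rfl, by simp⟩
  | cons φ φs ih =>
    filter_upwards [ih, getAwr_spec hXs hYs φ] with d ⟨b, h1, h2⟩ ⟨r, h3, h4⟩
    simp only [someUnrealizable, h3, Option.bind_some]
    match r, h4 with
    | none, h4 =>
      exact ⟨true, rfl, fun _ h => h4 (h.mono fun w hw => ((languageAll_cons φ φs w).1 hw).1)⟩
    | some R, _ =>
      exact ⟨b, h1, fun hb h => h2 hb (h.mono fun w hw => ((languageAll_cons φ φs w).1 hw).2)⟩

/-- What the composition with all formulas of a list of joint language `M` yields for a region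
that accepts `K`. -/
def IsComposeAllAnswer (K M : Language (Set (𝒳 ⊕ 𝒴))) : Option (Region 𝒳 𝒴) → Prop
  | none => ¬ AgentWins (K ⊓ M) []
  | some R => AgentWins R.dfa.accepts [] ∧ ∀ w ∈ R.dfa.accepts, w ∈ K ⊓ M

theorem composeAll_spec [Finite 𝒳] (hXs : ∀ X : Set 𝒳, X ∈ Xs) (hYs : ∀ Y : Set 𝒴, Y ∈ Ys)
    (v : Variant) (φs : List (LTLf (𝒳 ⊕ 𝒴))) :
    ∀ R : Region 𝒳 𝒴, R.EwDead → AgentWins R.dfa.accepts [] → [] ∉ R.dfa.accepts →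
      ∀ᶠ d in Filter.atTop, ∃ r, composeAll Xs Ys d v φs R = some r ∧
        IsComposeAllAnswer R.dfa.accepts (languageAll φs) r := by
  induction φs with
  | nil =>
    refine fun R _ hwin hne => Filter.Eventually.of_forall fun d => ⟨some R, rfl, hwin, ?_⟩
    exact fun w hw => ⟨hw, fun h => hne (h ▸ hw), by simp⟩
  | cons φ φs ih =>
    intro R hR hwin hne
    -- The bound `d₀` fixes one region `R'`, to which the induction hypothesis applies; monotonicity
    -- says that all larger bounds produce the same `R'`.
    obtain ⟨d₀, hd₀⟩ := (compose_spec hXs hYs v hR φ).exists_forall_of_atTop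
    obtain ⟨r, h1, h2⟩ := hd₀ d₀ le_rfl
    match r, h2 with
    | none, h2 =>
      filter_upwards [Filter.eventually_ge_atTop d₀] with d hd
      refine ⟨none, by rw [composeAll, compose_mono hd v R φ _ h1]; rfl, fun h => h2 (h.mono ?_)⟩
      exact fun w hw => ⟨hw.1, ((languageAll_cons φ φs w).1 hw.2).1⟩
    | some R', ⟨h2, h3, h4, h5⟩ =>
      filter_upwards [Filter.eventually_ge_atTop d₀, ih R' h2 h3 fun h => hne (h4 _ h).1]
        with d hd ⟨r, h6, h7⟩
      refine ⟨r, by rw [composeAll, compose_mono hd v R φ _ h1]; exact h6, ?_⟩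
      match r, h7 with
      | none, h7 =>
        -- The remaining conjuncts serve as the further condition `N`: a win for everything survives
        -- the replacement of `R` by `R'`.
        refine fun h => h7 ((h5 (languageAll φs) (h.mono fun w hw => ?_)).mono fun w hw =>
          And.intro hw.2 hw.1)
        obtain ⟨g1, g2⟩ := (languageAll_cons φ φs w).1 hw.2
        exact ⟨g2, hw.1, g1⟩
      | some R₁, ⟨h7, h8⟩ =>
        refine ⟨h7, fun w hw => ?_⟩
        obtain ⟨g1, g2⟩ := h8 w hw
        obtain ⟨g3, g4⟩ := h4 w g1
        exact ⟨g3, (languageAll_cons φ φs w).2 ⟨g4, g2⟩⟩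

theorem outcome_ne_nil (g : Strategy 𝒳 𝒴) (lam : ℕ → Set 𝒳) (k : ℕ) : outcome g lam k ≠ [] := by
  simp [outcome_eq_append]

theorem agentWins_of_realizable {φs : List (LTLf (𝒳 ⊕ 𝒴))} (h : Realizable (LTLf.bigConj φs)) :
    AgentWins (languageAll φs) [] := by
  obtain ⟨g, hg⟩ := h
  refine agentWins_nil_of_strategy g fun lam => (hg lam).imp fun k hk => ?_
  exact ⟨outcome_ne_nil g lam k, (sat_bigConj φs _).1 hk⟩

theorem synthesize_spec [Finite 𝒳] (hXs : ∀ X : Set 𝒳, X ∈ Xs) (hYs : ∀ Y : Set 𝒴, Y ∈ Ys)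
    (v : Variant) (φs : List (LTLf (𝒳 ⊕ 𝒴))) :
    ∃ d r, synthesize Xs Ys d v φs = some r ∧
      (r = none → ¬ Realizable (LTLf.bigConj φs)) ∧
      ∀ g, r = some g → IsWinning (LTLf.bigConj φs) g := by
  set R₀ : Region 𝒳 𝒴 := ⟨Game.ofFormula LTLf.tt, ∅⟩ with hR₀
  have hacc : ∀ w, w ∈ R₀.dfa.accepts ↔ w ≠ [] ∧ LTLf.tt.Sat w := LTLf.mem_accepts_dfa _
  have hwin : AgentWins R₀.dfa.accepts [] :=
    -- Any single letter is accepted by the game of `tt`, which rejects only the empty word.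
    .step ∅ fun X => .mem ((hacc _).2 ⟨by simp, trivial⟩)
  obtain ⟨d, ⟨b, h1, h2⟩, ⟨r, h3, h4⟩⟩ := ((someUnrealizable_spec hXs hYs φs).and
    (composeAll_spec hXs hYs v φs R₀ (fun s hs => absurd hs (Set.notMem_empty s)) hwin
      fun h => ((hacc _).1 h).1 rfl)).exists
  refine ⟨d, ?_⟩
  simp only [synthesize, h1, Option.bind_some]
  match b, h2 with
  | true, h2 => exact ⟨none, rfl, fun _ h => h2 rfl (agentWins_of_realizable h), by simp⟩
  | false, _ =>
    rw [← hR₀, h3]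
    match r, h4 with
    | none, h4 =>
      refine ⟨none, rfl, fun _ h => h4 ((agentWins_of_realizable h).mono fun w hw => ?_), by simp⟩
      exact ⟨(hacc w).2 ⟨hw.1, trivial⟩, hw⟩
    | some R, ⟨h4, h5⟩ =>
      refine ⟨some R.buildStrategy, rfl, by simp, ?_⟩
      rintro _ ⟨⟩ lam
      obtain ⟨k, hk⟩ := exists_outcome_mem_of_start_mem_solve R
        (R.start_mem_solve_iff.2 h4) (fun h => (h5 _ h).2.1 rfl) lam
      exact ⟨k, (sat_bigConj φs _).2 (h5 _ hk).2.2⟩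

end Algorithm

end CompSynth

theorem mainTheorem2 {𝒳 𝒴 : Type} [Finite 𝒳] [Finite 𝒴]
    (Xs : List (Set 𝒳)) (hXs : ∀ X : Set 𝒳, X ∈ Xs)
    (Ys : List (Set 𝒴)) (hYs : ∀ Y : Set 𝒴, Y ∈ Ys)
    (v : CompSynth.Variant) (φs : List (CompSynth.LTLf (𝒳 ⊕ 𝒴))) :
    ∃ r : Option (CompSynth.Strategy 𝒳 𝒴),
      (∀ r', CompSynth.Returns Xs Ys v φs r' ↔ r' = r) ∧
      (CompSynth.Realizable (CompSynth.LTLf.bigConj φs) ↔ ∃ g, r = some g) ∧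
      (∀ g, r = some g → CompSynth.IsWinning (CompSynth.LTLf.bigConj φs) g) := by
  obtain ⟨d, r, h1, h2, h3⟩ := CompSynth.synthesize_spec hXs hYs v φs
  refine ⟨r, fun r' => ⟨?_, ?_⟩, ⟨fun h => ?_, ?_⟩, h3⟩
  · rintro ⟨d', h'⟩
    -- Two answers found with different bounds are compared at the larger bound.
    have e1 := CompSynth.synthesize_mono (le_max_left d d') v φs _ h1
    have e2 := CompSynth.synthesize_mono (le_max_right d d') v φs _ h'
    exact Option.some_injective _ (e2.symm.trans e1)
  · rintro rfl
    exact ⟨d, h1⟩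
  · exact Option.ne_none_iff_exists'.1 fun hr => h2 hr h
  · rintro ⟨g, hg⟩
    exact ⟨g, h3 g hg⟩
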